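/- Let $m \ge 5$ be an integer and let $A_m$ denote the alternating group of degree $m$. Then there exist primes $p$ and $q$ with $m/2 \le p < q \le m$, where moreover $m/2 < p$ unless $m \in \{6, 10\}$, such that for all $x, y \in A_m$ with $|x| = p$ and $|y| = q$ (element orders), the subgroup $\langle x, y\rangle$ is isomorphic to the alternating group $A_d$ for some integer $d \ge 5$ (depending on $x$ and $y$). In particular, $\langle x, y\rangle$ is nonsolvable. -/

import Mathlib

/-! On the union of the two supports, of size n ≤ m, the primes exceed or nearly exceed n/2. Hence y
is a q-cycle, and x is a p-cycle unless n = 2p. Every nontrivial x-orbit meets the support of y, so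
the group is transitive; a cycle of prime length greater than n/2 then makes it primitive. Jordan's
theorem finishes when x is a p-cycle with three fixed points, which n ≥ q ≥ p + 3 guarantees. A
sharpened Bertrand postulate gives such a gap for m ≥ 17, and (7, 11) serves 11 ≤ m ≤ 13. The
remaining pairs (3, 5), (5, 7), (11, 13) leave exceptional degrees. In degrees 6 and 7, simplicity
of the alternating group and divisibility leave few indices, and in degree 6 a transitive A_5
survives. In degree 10, when x is a product of two 5-cycles, the 7-cycle y has three fixed points.
In degree 13, Burnside transfer in a point stabilizer forces 5 to divide the group order, and this
yields a 3-cycle or a 5-cycle. Jordan's theorem itself comes from multiple transitivity. Two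
transpositions of fixed points of x lift to the normalizer of ⟨x⟩; the commutator of the lifts
centralizes x, and a power of it is a 3-cycle. -/

/-! ### Two well-separated primes in the upper half of [1, m] -/

open Real in
/-- The inequality behind `Nat.exists_prime_pair_of_large`, over the reals. -/
theorem real_four_rpow_ge_of_large {x : ℝ} (x_large : (2048 : ℝ) ≤ x) :
    x * (2 * x) ^ 2 * (2 * x) ^ √(2 * x) * 4 ^ (2 * x / 3) ≤ 4 ^ x := by
  let f : ℝ → ℝ := fun x => log x + 2 * log (2 * x) + √(2 * x) * log (2 * x) - log 4 / 3 * x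
  have hpos : ∀ x : ℝ, 0 < x → 0 < x * (2 * x) ^ 2 * (2 * x) ^ √(2 * x) / 4 ^ (x / 3) := by
    intro x h
    positivity
  have hf : ∀ x : ℝ, 0 < x →
      f x = log (x * (2 * x) ^ 2 * (2 * x) ^ √(2 * x) / 4 ^ (x / 3)) := by
    intro x h5
    have h6 := mul_pos (zero_lt_two' ℝ) h5
    have h7 := rpow_pos_of_pos h6 (√(2 * x))
    rw [log_div (by positivity) (rpow_pos_of_pos four_pos _).ne', log_mul (by positivity) h7.ne',
      log_mul h5.ne' (by positivity), log_pow,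
      log_rpow h6, log_rpow zero_lt_four, ← mul_div_right_comm, ← mul_div, mul_comm x]
    rfl
  have h5 : 0 < x := lt_of_lt_of_le (by norm_num1) x_large
  rw [← div_le_one (rpow_pos_of_pos four_pos x), ← div_div_eq_mul_div, ← rpow_sub four_pos, ←
    mul_div 2 x, mul_div_left_comm, ← mul_one_sub, (by norm_num1 : (1 : ℝ) - 2 / 3 = 1 / 3),
    mul_one_div, ← log_nonpos_iff (hpos x h5).le, ← hf x h5]
  have hlin : ConcaveOn ℝ (Set.Ioi 0.5) fun x : ℝ => log (2 * x) := by
    refine ConcaveOn.congr (f := fun x : ℝ => log 2 + log x) ?_ ?_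
    · exact (concaveOn_const _ (convex_Ioi _)).add
        (strictConcaveOn_log_Ioi.concaveOn.subset (Set.Ioi_subset_Ioi (by norm_num)) (convex_Ioi 0.5))
    · intro x hx
      have : (0.5 : ℝ) < x := hx
      exact (log_mul two_ne_zero (by positivity)).symm
  have h : ConcaveOn ℝ (Set.Ioi 0.5) f := by
    apply ConcaveOn.sub
    · apply ConcaveOn.add
      · apply ConcaveOn.add
        · exact strictConcaveOn_log_Ioi.concaveOn.subset
            (Set.Ioi_subset_Ioi (by norm_num)) (convex_Ioi 0.5)
        · exact hlin.smul (by norm_num : (0 : ℝ) ≤ 2)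
      convert!
        ((strictConcaveOn_sqrt_mul_log_Ioi.concaveOn.comp_linearMap ((2 : ℝ) • LinearMap.id)))
        using 1
      ext x
      simp only [Set.mem_Ioi, Set.mem_preimage, LinearMap.smul_apply,
        LinearMap.id_coe, id_eq, smul_eq_mul]
      rw [← mul_lt_mul_iff_right₀ (two_pos)]
      norm_num1
      rfl
    apply ConvexOn.smul
    · refine div_nonneg (log_nonneg (by norm_num1)) (by norm_num1)
    · exact convexOn_id (convex_Ioi (0.5 : ℝ))
  -- A concave function that has dropped from a nonnegative to a nonpositive value stays
  -- nonpositive.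
  suffices ∃ x1 x2, 0.5 < x1 ∧ x1 < x2 ∧ x2 ≤ x ∧ 0 ≤ f x1 ∧ f x2 ≤ 0 by
    obtain ⟨x1, x2, h1, h2, h0, h3, h4⟩ := this
    exact (h.right_le_of_le_left'' h1 ((h1.trans h2).trans_le h0) h2 h0 (h4.trans h3)).trans h4
  -- At both points 2x is a perfect square, 36 and 4096, so the comparison involves integer
  -- exponents up to a factor 4 ^ (x / 3).
  refine ⟨18, 2048, by norm_num1, by norm_num1, x_large, ?_, ?_⟩
  · have : √(2 * 18 : ℝ) = 6 := (sqrt_eq_iff_mul_self_eq_of_pos (by norm_num1)).mpr (by norm_num1)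
    rw [hf _ (by norm_num1), log_nonneg_iff (by positivity), this, one_le_div (by norm_num1)]
    norm_num1
  · have : √(2 * 2048) = 64 :=
      (sqrt_eq_iff_mul_self_eq_of_pos (by norm_num1)).mpr (by norm_num1)
    rw [hf _ (by norm_num1), log_nonpos_iff (hpos _ (by norm_num1)).le, this,
        div_le_one (by positivity)]
    have e : (4 : ℝ) = 2 ^ (2 : ℝ) := by norm_num
    have e1 : (2048 : ℝ) * (2 * 2048) ^ 2 * (2 * 2048) ^ (64 : ℝ) = 2 ^ (803 : ℝ) := by
      rw [show (64 : ℝ) = ((64 : ℕ) : ℝ) by norm_num, show (803 : ℝ) = ((803 : ℕ) : ℝ) by norm_num,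
        rpow_natCast, rpow_natCast, show (2 * 2048 : ℝ) = 2 ^ 12 by norm_num,
        show (2048 : ℝ) = 2 ^ 11 by norm_num, ← pow_mul, ← pow_mul, ← pow_add, ← pow_add]
    rw [e1, e, ← rpow_mul (by norm_num)]
    exact rpow_le_rpow_of_exponent_le (by norm_num) (by norm_num)

namespace Nat

theorem mul_pow_sqrt_mul_le_four_pow {n : ℕ} (n_large : 2048 ≤ n) :
    n * (2 * n) ^ 2 * (2 * n) ^ sqrt (2 * n) * 4 ^ (2 * n / 3) ≤ 4 ^ n := by
  rw [← @cast_le ℝ]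
  have := real_four_rpow_ge_of_large (x := n) (by exact_mod_cast n_large)
  rw [Real.rpow_natCast] at this
  push_cast
  refine le_trans ?_ this
  rw [← Real.rpow_natCast _ (sqrt (2 * n)), ← Real.rpow_natCast _ (2 * n / 3)]
  gcongr
  · have n2_pos : 1 ≤ 2 * n := by omega
    exact mod_cast n2_pos
  · exact_mod_cast Real.nat_sqrt_le_real_sqrt
  · norm_num1
  · exact cast_div_le.trans (by norm_cast)

/-- If all primes in `(n, 2n]` lie in `T`, the central binomial coefficient is small. -/
theorem centralBinom_le_of_primes_subset (n : ℕ) (n_large : 2 < n) (T : Finset ℕ)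
    (hT : ∀ p : ℕ, p.Prime → n < p → p ≤ 2 * n → p ∈ T) :
    centralBinom n ≤ (2 * n) ^ T.card * ((2 * n) ^ sqrt (2 * n) * 4 ^ (2 * n / 3)) := by
  have n_pos : 0 < n := (Nat.zero_le _).trans_lt n_large
  have n2_pos : 1 ≤ 2 * n := by omega
  -- Primes in (2n/3, n] do not divide the central binomial coefficient, so only those up to 2n/3
  -- and those in `T` contribute.
  let S := {p ∈ Finset.range (2 * n / 3 + 1) | Nat.Prime p}
  let f x := x ^ n.centralBinom.factorization x
  have f_le (p : ℕ) : f p ≤ 2 * n := pow_factorization_choose_le (by omega)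
  have one_le_f (p : ℕ) : 1 ≤ f p := by
    rcases Nat.eq_zero_or_pos p with rfl | hp
    · simp [f]
    · exact Nat.one_le_pow _ _ hp
  have hprod : centralBinom n ≤ (∏ p ∈ T, f p) * ∏ p ∈ S, f p := by
    calc centralBinom n = ∏ p ∈ Finset.range (2 * n + 1), f p :=
          n.prod_pow_factorization_centralBinom.symm
      _ ≤ ∏ p ∈ T ∪ S, f p := by
          rw [← Finset.prod_filter_of_ne (p := fun p => f p ≠ 1) (fun _ _ h => h)]
          refine Finset.prod_le_prod_of_subset_of_one_le' ?_ fun p _ _ => one_le_f p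
          intro p hp
          simp only [Finset.mem_filter, Finset.mem_range] at hp
          obtain ⟨hp1, hp2⟩ := hp
          have hprime : p.Prime := by
            by_contra h
            exact hp2 (by simp [f, factorization_eq_zero_of_not_prime n.centralBinom h])
          rw [Finset.mem_union]
          rcases lt_or_ge n p with h | h
          · exact Or.inl (hT p hprime h (by omega))
          · right
            refine Finset.mem_filter.2 ⟨Finset.mem_range.2 ?_, hprime⟩
            by_contra h3
            refine hp2 ?_
            simp only [f]
            rw [factorization_centralBinom_of_two_mul_self_lt_three_mul n_large h (by omega),
              Nat.pow_zero]
      _ ≤ (∏ p ∈ T, f p) * ∏ p ∈ S, f p := by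
          rw [← Finset.prod_union_inter]
          exact Nat.le_mul_of_pos_right _ (Finset.prod_pos fun p _ => one_le_f p)
  refine hprod.trans (Nat.mul_le_mul (Finset.prod_le_pow_card _ _ _ fun p _ => f_le p) ?_)
  -- Primes up to √(2n) contribute at most 2n each; larger ones occur with exponent at most one, so
  -- the primorial bounds their product.
  rw [← Finset.prod_filter_mul_prod_filter_not S (· ≤ sqrt (2 * n))]
  apply mul_le_mul'
  · refine (Finset.prod_le_prod' fun p _ => f_le p).trans ?_
    have : (Finset.Icc 1 (sqrt (2 * n))).card = sqrt (2 * n) := by rw [card_Icc, Nat.add_sub_cancel]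
    rw [Finset.prod_const]
    refine pow_right_mono₀ n2_pos ((Finset.card_le_card fun x hx => ?_).trans this.le)
    obtain ⟨h1, h2⟩ := Finset.mem_filter.1 hx
    exact Finset.mem_Icc.mpr ⟨(Finset.mem_filter.1 h1).2.one_lt.le, h2⟩
  · refine le_trans ?_ (primorial_le_four_pow (2 * n / 3))
    refine (Finset.prod_le_prod' fun p hp => (?_ : f p ≤ p)).trans ?_
    · obtain ⟨h1, h2⟩ := Finset.mem_filter.1 hp
      refine (pow_right_mono₀ (Finset.mem_filter.1 h1).2.one_lt.le ?_).trans (pow_one p).le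
      exact Nat.factorization_choose_le_one (sqrt_lt'.mp <| not_le.1 h2)
    refine Finset.prod_le_prod_of_subset_of_one_le' (Finset.filter_subset _ _) ?_
    exact fun p hp _ => (Finset.mem_filter.1 hp).2.one_lt.le

/-- A sharpening of Bertrand's postulate for large `n`. -/
theorem exists_prime_pair_of_large (n : ℕ) (n_large : 2048 ≤ n) :
    ∃ p q : ℕ, p.Prime ∧ q.Prime ∧ n < p ∧ p + 3 ≤ q ∧ q ≤ 2 * n := by
  by_contra! hno
  obtain ⟨r, hr, hnr, hr2⟩ := exists_prime_lt_and_le_two_mul n (by omega)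
  have hodd (p : ℕ) (hp : p.Prime) (h : n < p) : p % 2 = 1 :=
    hp.eq_two_or_odd.resolve_left (by omega)
  -- Primes above n are odd, and no two of those in (n, 2n] differ by 3 or more, so there are at
  -- most two, at distance 2.
  obtain ⟨T, hTc, hT⟩ : ∃ T : Finset ℕ, T.card ≤ 2 ∧
      ∀ p : ℕ, p.Prime → n < p → p ≤ 2 * n → p ∈ T := by
    have key (p q : ℕ) (hp : p.Prime) (hq : q.Prime) (h1 : n < p) (h2 : n < q) (h3 : p ≤ 2 * n)
        (h4 : q ≤ 2 * n) : q ≤ p + 2 := by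
      by_contra h
      have := hno p q hp hq h1 (by omega)
      omega
    by_cases h : ∃ p : ℕ, p.Prime ∧ n < p ∧ p ≤ 2 * n ∧ p < r
    · obtain ⟨p, hp, h1, h2, h3⟩ := h
      refine ⟨{p, r}, Finset.card_le_two, fun z hz h4 h5 => ?_⟩
      have a1 := key p z hp hz h1 h4 h2 h5
      have a2 := key z r hz hr h4 hnr h5 hr2
      have a3 := key p r hp hr h1 hnr h2 hr2
      have a4 := hodd p hp h1
      have a5 := hodd r hr hnr
      have a6 := hodd z hz h4
      simp only [Finset.mem_insert, Finset.mem_singleton]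
      omega
    · push Not at h
      refine ⟨{r, r + 2}, Finset.card_le_two, fun z hz h4 h5 => ?_⟩
      have a1 := key r z hr hz hnr h4 hr2 h5
      have a2 := h z hz h4 h5
      have a5 := hodd r hr hnr
      have a6 := hodd z hz h4
      simp only [Finset.mem_insert, Finset.mem_singleton]
      omega
  have h1 := Nat.four_pow_lt_mul_centralBinom n (by omega)
  have h2 := centralBinom_le_of_primes_subset n (by omega) T hT
  have h3 := mul_pow_sqrt_mul_le_four_pow n_large
  have h4 : (2 * n) ^ T.card ≤ (2 * n) ^ 2 := Nat.pow_le_pow_right (by omega) hTc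
  have h5 : n * centralBinom n ≤
      n * ((2 * n) ^ 2 * ((2 * n) ^ sqrt (2 * n) * 4 ^ (2 * n / 3))) :=
    Nat.mul_le_mul_left _ (h2.trans (Nat.mul_le_mul_right _ h4))
  simp only [← mul_assoc] at h5
  omega

/-- Beyond `17`, the upper half of `[1, m]` contains two primes that are not close. -/
theorem exists_prime_pair (m : ℕ) (hm : 17 ≤ m) :
    ∃ p q : ℕ, p.Prime ∧ q.Prime ∧ m < 2 * p ∧ p + 3 ≤ q ∧ q ≤ m := by
  have key (p q : ℕ) (hp : p.Prime) (hq : q.Prime) (h : p + 3 ≤ q) (h1 : m < 2 * p) (h2 : q ≤ m) :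
      ∃ p q : ℕ, p.Prime ∧ q.Prime ∧ m < 2 * p ∧ p + 3 ≤ q ∧ q ≤ m :=
    ⟨p, q, hp, hq, h1, h, h2⟩
  -- A pair (p, q) serves every m with q ≤ m < 2p; the listed intervals overlap up to 4096 = 2 ·
  -- 2048.
  rcases lt_or_ge m 4096 with h | h
  · by_cases h1 : m < 22
    · exact key 11 17 (by norm_num) (by norm_num) (by norm_num) (by omega) (by omega)
    by_cases h1 : m < 26
    · exact key 13 19 (by norm_num) (by norm_num) (by norm_num) (by omega) (by omega)
    by_cases h1 : m < 34
    · exact key 17 23 (by norm_num) (by norm_num) (by norm_num) (by omega) (by omega)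
    by_cases h1 : m < 46
    · exact key 23 31 (by norm_num) (by norm_num) (by norm_num) (by omega) (by omega)
    by_cases h1 : m < 74
    · exact key 37 43 (by norm_num) (by norm_num) (by norm_num) (by omega) (by omega)
    by_cases h1 : m < 122
    · exact key 61 71 (by norm_num) (by norm_num) (by norm_num) (by omega) (by omega)
    by_cases h1 : m < 218
    · exact key 109 113 (by norm_num) (by norm_num) (by norm_num) (by omega) (by omega)
    by_cases h1 : m < 398
    · exact key 199 211 (by norm_num) (by norm_num) (by norm_num) (by omega) (by omega)
    by_cases h1 : m < 778
    · exact key 389 397 (by norm_num) (by norm_num) (by norm_num) (by omega) (by omega)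
    by_cases h1 : m < 1522
    · exact key 761 773 (by norm_num) (by norm_num) (by norm_num) (by omega) (by omega)
    by_cases h1 : m < 2998
    · exact key 1499 1511 (by norm_num) (by norm_num) (by norm_num) (by omega) (by omega)
    · exact key 2963 2971 (by norm_num) (by norm_num) (by norm_num) (by omega) (by omega)
  · obtain ⟨p, q, hp, hq, h1, h2, h3⟩ := exists_prime_pair_of_large (m / 2) (by omega)
    exact key p q hp hq h2 (by omega) (by omega)

end Nat

/-! ### Jordan's theorem on primitive groups containing a prime cycle -/

open Equiv Equiv.Perm MulAction

/-- Both cyclic subgroups have order the full p-part of the group order, so they are conjugate Sylow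
subgroups. -/
theorem exists_conj_mem_zpowers {H : Type*} [Group H] [Finite H] {p : ℕ} (hp : p.Prime)
    (hH : ¬ p ^ 2 ∣ Nat.card H) {x z : H} (hx : orderOf x = p) (hz : orderOf z = p) :
    ∃ h : H, h * z * h⁻¹ ∈ Subgroup.zpowers x := by
  have := Fact.mk hp
  have hfac : (Nat.card H).factorization p = 1 := by
    refine le_antisymm ?_ ?_
    · by_contra h
      exact hH ((hp.pow_dvd_iff_le_factorization Nat.card_pos.ne').2 (by omega))
    · refine (hp.dvd_iff_one_le_factorization Nat.card_pos.ne').1 ?_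
      exact hx ▸ orderOf_dvd_natCard x
  let P : Sylow p H := Sylow.ofCard (Subgroup.zpowers x) (by rw [Nat.card_zpowers, hx, hfac, pow_one])
  let Q : Sylow p H := Sylow.ofCard (Subgroup.zpowers z) (by rw [Nat.card_zpowers, hz, hfac, pow_one])
  obtain ⟨h, hh⟩ := exists_smul_eq H Q P
  refine ⟨h, ?_⟩
  have h1 : h * z * h⁻¹ ∈ h • Q := by
    rw [Sylow.smul_def]
    exact (Subgroup.smul_mem_pointwise_smul z (MulAut.conj h) _ (Subgroup.mem_zpowers z))
  rw [hh] at h1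
  exact h1

namespace Equiv.Perm

variable {α : Type*}

theorem pow_apply_eq_pow_apply_of_prime {x : Perm α} {p : ℕ} (hp : p.Prime) (hx : x ^ p = 1) {b : α}
    (hb : x b ≠ b) {i j : ℕ} (hi : i < p) (hj : j < p) (h : (x ^ i) b = (x ^ j) b) : i = j := by
  have hper : Function.IsPeriodicPt x p b := by
    rw [Function.IsPeriodicPt, Function.IsFixedPt, Equiv.Perm.iterate_eq_pow, hx, one_apply]
  have hmin : Function.minimalPeriod x b = p := by
    rcases (Nat.dvd_prime hp).1 hper.minimalPeriod_dvd with h1 | h1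
    · exact absurd (Function.minimalPeriod_eq_one_iff_isFixedPt.1 h1) hb
    · exact h1
  rw [← Equiv.Perm.iterate_eq_pow, ← Equiv.Perm.iterate_eq_pow] at h
  exact (Function.iterate_injOn_Iio_minimalPeriod (by rw [hmin]; exact hi) (by rw [hmin]; exact hj) h)

theorem pow_mul_apply_eq_of_commute {c x : Perm α} (h : Commute c x) {a : α} {d e : ℕ}
    (hd : (c ^ d) a = (x ^ e) a) (k : ℕ) : (c ^ (d * k)) a = (x ^ (e * k)) a := by
  induction k with
  | zero => simp
  | succ k ih =>
    have hc : Commute (c ^ (d * k)) (x ^ e) := h.pow_pow _ _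
    rw [Nat.mul_succ, pow_add, mul_apply, hd, ← mul_apply, hc.eq, mul_apply, ih, ← mul_apply,
      ← pow_add, Nat.mul_succ, add_comm]

variable [Fintype α] [DecidableEq α]

/-- If `x` has prime order `p` and at most two nontrivial cycles, the centralizer of `x` acts on
the support of `x` with exponent dividing `2 * p`. -/
theorem pow_two_mul_apply_eq_self_of_commute {c x : Perm α} (h : Commute c x) {p : ℕ}
    (hp : p.Prime) (hx : orderOf x = p) (hs : x.support.card < 3 * p) {a : α}
    (ha : a ∈ x.support) : (c ^ (2 * p)) a = a := by
  have hxp : x ^ p = 1 := hx ▸ pow_orderOf_eq_one x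
  -- At most two nontrivial cycles are permuted by c, so c or its square sends a into its own
  -- x-cycle.
  suffices ∃ d e : ℕ, d ∣ 2 ∧ (c ^ d) a = (x ^ e) a by
    obtain ⟨d, e, ⟨k, hk⟩, hd⟩ := this
    have := pow_mul_apply_eq_of_commute h hd (k * p)
    rw [← mul_assoc, ← hk] at this
    rw [this, mul_comm k p, ← mul_assoc, mul_comm e p, mul_assoc, pow_mul, hxp, one_pow, one_apply]
  have hmoved (j : ℕ) : x ((c ^ j) a) ≠ (c ^ j) a := by
    intro hf
    rw [← mul_apply, ← (h.pow_left j).eq, mul_apply] at hf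
    exact (mem_support.1 ha) ((c ^ j).injective hf)
  -- These 3p points cannot be distinct in a smaller support. Since x-orbits here have p points, a
  -- collision involves two different powers of c.
  let f : Fin p × Fin 3 → α := fun ij => (x ^ (ij.1 : ℕ)) ((c ^ (ij.2 : ℕ)) a)
  obtain ⟨u, -, v, -, huv, hf⟩ := Finset.exists_ne_map_eq_of_card_lt_of_maps_to
    (s := (Finset.univ : Finset (Fin p × Fin 3))) (t := x.support) (f := f)
    (by simpa [mul_comm] using hs) (fun ij _ => by
      simp only [f]
      rw [Finset.mem_coe, pow_apply_mem_support]
      exact mem_support.2 (hmoved _))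
  wlog hle : u.2 ≤ v.2 generalizing u v
  · exact this v u huv.symm hf.symm (le_of_not_ge hle)
  rcases hle.eq_or_lt with heq | hlt
  · refine absurd (Prod.ext (Fin.ext ?_) heq) huv
    simp only [f, heq] at hf
    exact pow_apply_eq_pow_apply_of_prime hp hxp (hmoved _) u.1.2 v.1.2 hf
  refine ⟨v.2 - u.2, u.1 + (p - v.1), ?_, ?_⟩
  · have h1 : (u.2 : ℕ) < v.2 := hlt
    have h2 := v.2.2
    obtain h3 | h3 : (v.2 : ℕ) - u.2 = 1 ∨ (v.2 : ℕ) - u.2 = 2 := by omega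
    all_goals simp [h3]
  · simp only [f] at hf
    have h1 : (u.2 : ℕ) ≤ v.2 := hle
    apply (c ^ (u.2 : ℕ)).injective
    apply (x ^ (v.1 : ℕ)).injective
    rw [← mul_apply (c ^ _), ← pow_add, Nat.add_sub_cancel' h1, ← hf, ← mul_apply (c ^ _),
      (h.pow_pow _ _).eq, mul_apply, ← mul_apply (x ^ (v.1 : ℕ)), ← pow_add,
      show (v.1 : ℕ) + (u.1 + (p - v.1)) = u.1 + p by have := v.1.2; omega, pow_add, hxp, mul_one]

/-- Lifting permutations of the fixed points of `x` to the normalizer of `⟨x⟩`, when `⟨x⟩` is a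
Sylow subgroup of the pointwise stabilizer of its fixed points. -/
theorem exists_mem_normalizing_of_isMultiplyPretransitive {G : Subgroup (Perm α)} {x : Perm α}
    (hxG : x ∈ G) {p : ℕ} (hp : p.Prime) (hx : orderOf x = p)
    (hG : IsMultiplyPretransitive G α x.supportᶜ.card)
    (hcard : ¬ p ^ 2 ∣ Nat.card (G ⊓ fixingSubgroup (Perm α) (x.support : Set α)ᶜ : Subgroup _))
    {σ : Perm α} (hσ : ∀ a ∉ x.support, σ a ∉ x.support) :
    ∃ n ∈ G, (∀ a ∉ x.support, n a = σ a) ∧ ∃ k : ℕ, n * x * n⁻¹ = x ^ k := by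
  let H : Subgroup (Perm α) := G ⊓ fixingSubgroup (Perm α) (x.support : Set α)ᶜ
  have hfix {g : Perm α} : g ∈ fixingSubgroup (Perm α) (x.support : Set α)ᶜ ↔
      ∀ a ∉ x.support, g a = a := by
    simp [mem_fixingSubgroup_iff]
  let e : Fin x.supportᶜ.card ↪ α :=
    (x.supportᶜ.equivFin.symm.toEmbedding).trans (Function.Embedding.subtype _)
  obtain ⟨g, hg⟩ := exists_smul_eq G e (e.trans σ.toEmbedding)
  have hg' (a : α) (ha : a ∉ x.support) : (g : Perm α) a = σ a := by
    have := DFunLike.congr_fun hg (x.supportᶜ.equivFin ⟨a, Finset.mem_compl.2 ha⟩)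
    simpa [e] using! this
  have hginv (a : α) (ha : a ∉ x.support) : (g : Perm α)⁻¹ a ∉ x.support := by
    have hmaps : Set.MapsTo (g : Perm α) (x.supportᶜ : Finset α) (x.supportᶜ : Finset α) := by
      intro b hb
      simp only [Finset.coe_compl, Set.mem_compl_iff, Finset.mem_coe] at hb ⊢
      rw [hg' b hb]
      exact hσ b hb
    obtain ⟨b, hb, rfl⟩ := Finset.surjOn_of_injOn_of_card_le _ hmaps (g : Perm α).injective.injOn
      le_rfl (show a ∈ ((x.supportᶜ : Finset α) : Set α) by simpa using ha)
    simpa using hb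
  have hxH : x ∈ H := ⟨hxG, hfix.2 fun a ha => notMem_support.1 ha⟩
  have hzH : (g : Perm α) * x * (g : Perm α)⁻¹ ∈ H := by
    refine ⟨G.mul_mem (G.mul_mem g.2 hxG) (G.inv_mem g.2), hfix.2 fun a ha => ?_⟩
    rw [mul_apply, mul_apply, notMem_support.1 (hginv a ha), ← mul_apply, mul_inv_cancel, one_apply]
  -- Frattini correction: g x g⁻¹ again lies in `H`, where ⟨x⟩ is Sylow, and a conjugator from `H`
  -- does not disturb the values of g on the fixed points.
  obtain ⟨h, hh⟩ := exists_conj_mem_zpowers (H := H) hp hcard (x := ⟨x, hxH⟩) (z := ⟨_, hzH⟩)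
    (by rw [Subgroup.orderOf_mk, hx])
    (by
      rw [Subgroup.orderOf_mk, ← hx]
      exact MulEquiv.orderOf_eq (MulAut.conj (g : Perm α)) x)
  have hhG : (h : Perm α) ∈ G := h.2.1
  refine ⟨h * g, G.mul_mem hhG g.2, fun a ha => ?_, ?_⟩
  · rw [mul_apply, hg' a ha]
    exact hfix.1 h.2.2 _ (hσ a ha)
  · obtain ⟨k, hk⟩ := (mem_powers_iff_mem_zpowers.2 hh)
    refine ⟨k, ?_⟩
    have := congrArg (Subtype.val) hk
    simp only [SubmonoidClass.mk_pow, Subgroup.coe_mul, Subgroup.coe_inv] at this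
    rw [this]
    group

/-- Automorphisms of ⟨x⟩ commute, so the commutator of two elements normalizing ⟨x⟩ centralizes x.
It is arranged to be a 3-cycle on the fixed points, and its power 2p is trivial on the support while
still a 3-cycle outside, since p ≠ 3. Allowing two p-cycles in x is needed in degree 13 with p = 5.
-/
theorem exists_isThreeCycle_mem_of_isMultiplyPretransitive {G : Subgroup (Perm α)} {x : Perm α}
    (hxG : x ∈ G) {p : ℕ} (hp : p.Prime) (hp3 : p ≠ 3) (hx : orderOf x = p)
    (hs : x.support.card < 3 * p) (hF : 3 ≤ x.supportᶜ.card)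
    (hG : IsMultiplyPretransitive G α x.supportᶜ.card)
    (hcard : ¬ p ^ 2 ∣ Nat.card (G ⊓ fixingSubgroup (Perm α) (x.support : Set α)ᶜ : Subgroup _)) :
    ∃ g ∈ G, g.IsThreeCycle := by
  obtain ⟨a, ha, b, hb, c, hc, hab, hac, hbc⟩ := Finset.two_lt_card.1 hF
  rw [Finset.mem_compl] at ha hb hc
  have hswap {u v : α} (hu : u ∉ x.support) (hv : v ∉ x.support) (w : α) (hw : w ∉ x.support) :
      swap u v w ∉ x.support := by
    rw [swap_apply_def]
    split_ifs <;> assumption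
  have hswap' {u v : α} (hu : u ∉ x.support) (hv : v ∉ x.support) (w : α) (hw : w ∈ x.support) :
      swap u v w = w :=
    swap_apply_of_ne_of_ne (fun h => hu (h ▸ hw)) (fun h => hv (h ▸ hw))
  obtain ⟨n₁, hn₁G, hn₁, k₁, hk₁⟩ :=
    exists_mem_normalizing_of_isMultiplyPretransitive hxG hp hx hG hcard (hswap ha hb)
  obtain ⟨n₂, hn₂G, hn₂, k₂, hk₂⟩ :=
    exists_mem_normalizing_of_isMultiplyPretransitive hxG hp hx hG hcard (hswap ha hc)
  -- The commutator of two transpositions sharing one point is the square of a 3-cycle.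
  let t : Perm α := swap a b * swap a c * (swap a b * swap a c)
  have ht : t.IsThreeCycle := (isThreeCycle_swap_mul_swap_same hab hac hbc).isThreeCycle_sq
  let d : Perm α := (n₂ * n₁)⁻¹ * (n₁ * n₂)
  have hd : Commute d x := by
    have h1 : n₁ * n₂ * x * (n₁ * n₂)⁻¹ = x ^ (k₁ * k₂) := by
      rw [pow_mul, ← hk₁, conj_pow, ← hk₂]
      group
    have h2 : n₂ * n₁ * x * (n₂ * n₁)⁻¹ = x ^ (k₁ * k₂) := by
      rw [mul_comm k₁ k₂, pow_mul, ← hk₂, conj_pow, ← hk₁]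
      group
    have h3 := h1.trans h2.symm
    have h4 : n₁ * n₂ * x = n₂ * n₁ * x * (n₂ * n₁)⁻¹ * (n₁ * n₂) := by
      rw [← h3]; group
    change (n₂ * n₁)⁻¹ * (n₁ * n₂) * x = x * ((n₂ * n₁)⁻¹ * (n₁ * n₂))
    rw [mul_assoc, h4]
    group
  have hdF (w : α) (hw : w ∉ x.support) : d w = t w := by
    have e1 := hswap ha hc w hw
    have e2 := hswap ha hb _ e1
    have e3 := hswap ha hc _ e2
    have e4 := hswap ha hb _ e3
    change (n₂ * n₁)⁻¹ (n₁ (n₂ w)) = _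
    rw [inv_eq_iff_eq, hn₂ _ hw, hn₁ _ e1]
    simp only [t, mul_apply]
    rw [hn₁ _ e4, swap_apply_self, hn₂ _ e3, swap_apply_self]
  have htF (w : α) (hw : w ∉ x.support) : t w ∉ x.support := by
    simp only [t, mul_apply]
    exact hswap ha hb _ (hswap ha hc _ (hswap ha hb _ (hswap ha hc _ hw)))
  have hpow : d ^ (2 * p) = t ^ (2 * p) := by
    ext w
    by_cases hw : w ∈ x.support
    · rw [pow_two_mul_apply_eq_self_of_commute hd hp hx hs hw]
      have h1 : t w = w := by
        simp only [t, mul_apply]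
        rw [hswap' ha hc w hw, hswap' ha hb w hw, hswap' ha hc w hw, hswap' ha hb w hw]
      exact (pow_apply_eq_self_of_apply_eq_self h1 _).symm
    · have (k : ℕ) : (d ^ k) w = (t ^ k) w ∧ (t ^ k) w ∉ x.support := by
        induction k with
        | zero => simpa using hw
        | succ k ih =>
          rw [pow_succ', mul_apply, ih.1, hdF _ ih.2, pow_succ', mul_apply]
          exact ⟨rfl, htF _ ih.2⟩
      exact (this _).1
  refine ⟨t ^ (2 * p), ?_, ?_⟩
  · rw [← hpow]
    exact G.pow_mem (G.mul_mem (G.inv_mem (G.mul_mem hn₂G hn₁G)) (G.mul_mem hn₁G hn₂G)) _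
  · rw [← card_support_eq_three_iff, support_pow_coprime, ht.card_support]
    rw [ht.orderOf, Nat.coprime_comm]
    refine Nat.Coprime.mul_right (by norm_num) ?_
    exact (Nat.coprime_primes Nat.prime_three hp).2 hp3.symm

theorem card_inf_fixingSubgroup_dvd_factorial (G : Subgroup (Perm α)) (s : Finset α) :
    Nat.card (G ⊓ fixingSubgroup (Perm α) (s : Set α)ᶜ : Subgroup _) ∣ s.card.factorial := by
  have h : G ⊓ fixingSubgroup (Perm α) (s : Set α)ᶜ ≤
      (ofSubtype : Perm (Subtype (· ∈ s)) →* Perm α).range := by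
    intro g hg
    rw [mem_range_ofSubtype_iff]
    intro a ha
    by_contra has
    have := (mem_fixingSubgroup_iff (Perm α)).1 hg.2 a has
    exact (mem_support.1 ha) this
  refine (Subgroup.card_dvd_of_le h).trans ?_
  rw [Nat.card_congr (MonoidHom.ofInjective ofSubtype_injective).symm.toEquiv, Nat.card_perm]
  simp

theorem isPreprimitive_fixingSubgroup_of_isCycle {G : Subgroup (Perm α)} {g : Perm α}
    (hg : g ∈ G) (hc : g.IsCycle) (hp : g.support.card.Prime) :
    IsPreprimitive (fixingSubgroup G (g.support : Set α)ᶜ)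
      (SubMulAction.ofFixingSubgroup G (g.support : Set α)ᶜ) := by
  have := isPretransitive_of_isCycle_mem hc hg
  apply IsPreprimitive.of_prime_card
  have h : Nat.card (SubMulAction.ofFixingSubgroup G (g.support : Set α)ᶜ) = g.support.card := by
    rw [← Set.ncard_coe_finset, ← Nat.card_coe_set_eq]
    refine Nat.card_congr (Equiv.subtypeEquivRight fun a => ?_)
    simp [SubMulAction.mem_ofFixingSubgroup_iff]
  rwa [h]

/-- The cycle is primitive on its support, being transitive of prime degree, and that support holds
more than half of the points. -/
theorem isPreprimitive_of_isCycle_mem {G : Subgroup (Perm α)} [IsPretransitive G α] {g : Perm α}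
    (hg : g ∈ G) (hc : g.IsCycle) (hp : g.support.card.Prime)
    (hα : Nat.card α < 2 * g.support.card) : IsPreprimitive G α := by
  have := isPreprimitive_fixingSubgroup_of_isCycle hg hc hp
  let f : SubMulAction.ofFixingSubgroup G (g.support : Set α)ᶜ
      →ₑ[(fixingSubgroup G (g.support : Set α)ᶜ).subtype] α :=
    { toFun := Subtype.val, map_smul' := fun _ _ => rfl }
  refine IsPreprimitive.of_card_lt (f := f) ?_
  have : Set.range f = (g.support : Set α) := by
    change Set.range Subtype.val = _
    ext a
    simp [SubMulAction.mem_ofFixingSubgroup_iff]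
  rwa [this, Set.ncard_coe_finset]

/-- Jordan's multiple transitivity criterion: the pointwise stabilizer of the k + 1 fixed points of
g is primitive on the remaining ones. -/
theorem isMultiplyPretransitive_of_isCycle_mem {G : Subgroup (Perm α)} (hG : IsPreprimitive G α)
    {g : Perm α} (hg : g ∈ G) (hc : g.IsCycle) (hp : g.support.card.Prime) {k : ℕ}
    (hα : Nat.card α = g.support.card + (k + 1)) :
    IsMultiplyPretransitive G α (k + 2) := by
  have h := isPreprimitive_fixingSubgroup_of_isCycle hg hc hp
  have h2 := hp.two_le
  have hn : ((g.support : Set α)ᶜ).ncard = k + 1 := by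
    have := Set.ncard_add_ncard_compl (g.support : Set α)
    rw [Set.ncard_coe_finset] at this
    omega
  exact (hG.isMultiplyPreprimitive hn (by omega) h).isMultiplyPretransitive

/-- **Jordan's theorem**: a primitive group containing a cycle of prime length with at least
three fixed points contains the alternating group. -/
theorem alternatingGroup_le_of_isPreprimitive_of_isCycle_mem {G : Subgroup (Perm α)}
    (hG : IsPreprimitive G α) {g : Perm α} (hg : g ∈ G) (hc : g.IsCycle)
    (hp : g.support.card.Prime) (hα : g.support.card + 3 ≤ Nat.card α) :
    alternatingGroup α ≤ G := by
  by_cases h3 : g.support.card = 3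
  · exact alternatingGroup_le_of_isPreprimitive_of_isThreeCycle_mem hG
      (card_support_eq_three_iff.1 h3) hg
  obtain ⟨k, hk⟩ : ∃ k, Nat.card α = g.support.card + (k + 1) :=
    ⟨Nat.card α - g.support.card - 1, by omega⟩
  have hF : g.supportᶜ.card = k + 1 := by
    rw [Finset.card_compl, ← Nat.card_eq_fintype_card]
    omega
  have hk2 := isMultiplyPretransitive_of_isCycle_mem hG hg hc hp hk
  have h2 := hp.two_le
  obtain ⟨t, ht, ht3⟩ := exists_isThreeCycle_mem_of_isMultiplyPretransitive hg hp h3 hc.orderOf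
    (by omega) (by omega)
    (by rw [hF]; exact isMultiplyPretransitive_of_le (n := k + 2) (by omega) (by omega))
    -- The pointwise stabilizer embeds in the symmetric group on p points, and p² does not divide
    -- p!.
    (fun h => by
      have h4 := h.trans (card_inf_fixingSubgroup_dvd_factorial G g.support)
      rw [← Nat.mul_factorial_pred hp.ne_zero, pow_two] at h4
      have h5 := Nat.dvd_of_mul_dvd_mul_left hp.pos h4
      rw [hp.dvd_factorial] at h5
      omega)
  exact alternatingGroup_le_of_isPreprimitive_of_isThreeCycle_mem hG ht3 ht

end Equiv.Perm

/-! ### Burnside transfer and commuting elements -/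

/-- If a Sylow `p`-subgroup of order `p` is central in its normalizer, then some element of
order `p` normalizes a nontrivial `r`-subgroup for every other prime divisor `r` of the order. -/
theorem exists_orderOf_mem_normalizer_of_normalizer_le_centralizer {S : Type*} [Group S] [Finite S]
    {p r : ℕ} [Fact p.Prime] [Fact r.Prime] (hpr : r ≠ p) (P : Sylow p S)
    (hPc : Nat.card P = p)
    (hP : Subgroup.normalizer P ≤ Subgroup.centralizer (P : Set S)) (hr : r ∣ Nat.card S) :
    ∃ (z : S) (T : Subgroup S), orderOf z = p ∧ IsPGroup r T ∧ T ≠ ⊥ ∧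
      z ∈ Subgroup.normalizer (T : Set S) := by
  -- Burnside's theorem: `K` is a normal p-complement.
  let K : Subgroup S := (MonoidHom.transferSylow P hP).ker
  have hK : K.IsComplement' P := MonoidHom.ker_transferSylow_isComplement' P hP
  have hcard : Nat.card K * p = Nat.card S := hPc ▸ hK.card_mul_card
  have hrK : r ∣ Nat.card K := by
    rw [← hcard, (Fact.out : r.Prime).dvd_mul] at hr
    exact hr.resolve_right fun h =>
      hpr ((Nat.prime_dvd_prime_iff_eq Fact.out Fact.out).1 h)
  let T : Sylow r K := default
  let T' : Subgroup S := T.map K.subtype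
  have hindex : K.index = p := by
    have := K.card_mul_index
    rw [← hcard] at this
    exact Nat.eq_of_mul_eq_mul_left Nat.card_pos this
  -- Frattini argument: the normalizer of `T'` together with `K` is everything, so its order is
  -- divisible by the index p of `K`.
  have hN : p ∣ Nat.card (Subgroup.normalizer (T' : Set S)) := by
    have h1 := Sylow.normalizer_sup_eq_top T
    have h2 := Subgroup.relIndex_sup_right (Subgroup.normalizer (T' : Set S)) K
    rw [h1, Subgroup.relIndex_top_right, hindex] at h2
    rw [h2]
    exact Subgroup.relIndex_dvd_card _ _
  obtain ⟨z, hz⟩ := exists_prime_orderOf_dvd_card' p hN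
  refine ⟨z, T', ?_, T.2.map _, ?_, z.2⟩
  · rw [Subgroup.orderOf_coe, hz]
  · intro h
    have h3 : (T : Subgroup K) = ⊥ := (Subgroup.map_eq_bot_iff_of_injective _ K.subtype_injective).1 h
    exact T.ne_bot_of_dvd_card hrK h3

/-- Under the same hypothesis, some element of order `p` commutes with a nontrivial element of
`r`-power order, unless `p ∣ r ^ i - 1` for some `r ^ i` dividing the group order. -/
theorem exists_commute_of_normalizer_le_centralizer {S : Type*} [Group S] [Finite S]
    {p r : ℕ} [Fact p.Prime] [Fact r.Prime] (hpr : r ≠ p) (P : Sylow p S)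
    (hPc : Nat.card P = p)
    (hP : Subgroup.normalizer P ≤ Subgroup.centralizer (P : Set S)) (hr : r ∣ Nat.card S)
    (hmod : ∀ i, 0 < i → r ^ i ∣ Nat.card S → ¬ r ^ i ≡ 1 [MOD p]) :
    ∃ z t : S, orderOf z = p ∧ t ≠ 1 ∧ (∃ k, t ^ r ^ k = 1) ∧ Commute t z := by
  obtain ⟨z, T, hz, hT, hT1, hzT⟩ :=
    exists_orderOf_mem_normalizer_of_normalizer_le_centralizer hpr P hPc hP hr
  obtain ⟨i, hi⟩ := IsPGroup.iff_card.1 hT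
  have hi0 : 0 < i := by
    rcases Nat.eq_zero_or_pos i with rfl | h
    · exact absurd (Subgroup.eq_bot_of_card_eq T (by simpa using hi)) hT1
    · exact h
  let φ : Subgroup.normalizer (T : Set S) →* MulAut T := T.normalizerMonoidHom
  let Z : Subgroup (Subgroup.normalizer (T : Set S)) := Subgroup.zpowers ⟨z, hzT⟩
  let act : MulAction Z T := MulAction.compHom T (φ.comp Z.subtype)
  have hZ : IsPGroup p Z := by
    refine IsPGroup.of_card (n := 1) ?_
    rw [Nat.card_zpowers, Subgroup.orderOf_mk, hz, pow_one]
  -- The number of elements of `T` centralized by z is congruent to r ^ i modulo p, hence is not 1.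
  have h1 := hZ.card_modEq_card_fixedPoints T
  rw [hi] at h1
  have h2 : Nat.card (fixedPoints Z T) ≠ 1 := by
    intro h
    rw [h] at h1
    exact hmod i hi0 (hi ▸ T.card_subgroup_dvd_card) h1
  have hone : (1 : T) ∈ fixedPoints Z T := fun g => map_one (φ g)
  have h3 : ∃ t ∈ fixedPoints Z T, t ≠ 1 := by
    by_contra! hall
    refine h2 ?_
    rw [Nat.card_eq_one_iff_unique]
    exact ⟨⟨fun a b => Subtype.ext ((hall a a.2).trans (hall b b.2).symm)⟩, ⟨⟨1, hone⟩⟩⟩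
  obtain ⟨t, ht, ht1⟩ := h3
  refine ⟨z, t, hz, fun h => ht1 (Subtype.ext h), ?_, ?_⟩
  · obtain ⟨k, hk⟩ := hT t
    exact ⟨k, by simpa using congrArg Subtype.val hk⟩
  · have h4 := congrArg Subtype.val (ht ⟨⟨z, hzT⟩, Subgroup.mem_zpowers _⟩)
    change z * (t : S) * z⁻¹ = t at h4
    exact (mul_inv_eq_iff_eq_mul.1 h4).symm

/-! ### Primitive groups of degree 13 containing an 11-cycle -/

namespace Equiv.Perm

variable {α : Type*} [Fintype α] [DecidableEq α]

theorem card_support_eq_mul_of_prime_order {x : Perm α} {p : ℕ} (hp : p.Prime)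
    (hx : orderOf x = p) : ∃ n : ℕ, x.support.card = (n + 1) * p := by
  obtain ⟨n, hn⟩ := cycleType_prime_order (σ := x) (hx ▸ hp)
  exact ⟨n, by rw [← sum_cycleType, hn, Multiset.sum_replicate, hx, smul_eq_mul]⟩

theorem isCycle_and_card_support_of_card_support_lt {x : Perm α} {p : ℕ} (hp : p.Prime)
    (hx : orderOf x = p) (h : x.support.card < 2 * p) : x.IsCycle ∧ x.support.card = p := by
  have hc : x.IsCycle := isCycle_of_prime_order (hx ▸ hp) (hx ▸ h)
  exact ⟨hc, by rw [← hc.orderOf, hx]⟩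

theorem isCycle_and_card_support_of_card_lt {x : Perm α} {p : ℕ} (hp : p.Prime)
    (hx : orderOf x = p) (h : Nat.card α < 2 * p) : x.IsCycle ∧ x.support.card = p :=
  isCycle_and_card_support_of_card_support_lt hp hx
    ((Finset.card_le_univ _).trans_lt (Nat.card_eq_fintype_card (α := α) ▸ h))

theorem apply_eq_self_of_card_compl_support_eq_two {x t : Perm α} (h : x.supportᶜ.card = 2) {a : α}
    (ha : a ∉ x.support) (hta : t a = a) (ht : ∀ c ∉ x.support, t c ∉ x.support) :
    ∀ c ∉ x.support, t c = c := by
  intro c hc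
  by_contra hne
  have hca : c ≠ a := fun h => hne (h ▸ hta)
  have h3 : t c ≠ a := fun h => hca (t.injective (h.trans hta.symm))
  have : 2 < x.supportᶜ.card := Finset.two_lt_card.2
    ⟨a, Finset.mem_compl.2 ha, c, Finset.mem_compl.2 hc, t c, Finset.mem_compl.2 (ht c hc),
      hca.symm, h3.symm, Ne.symm hne⟩
  omega

/-- On the support of a cycle z, a commuting permutation acts as a power of z. -/
theorem pow_orderOf_eq_one_of_commute {t z : Perm α} (h : Commute t z) (hz : z.IsCycle)
    (hfix : ∀ c ∉ z.support, t c = c) : t ^ orderOf z = 1 := by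
  ext c
  by_cases hc : c ∈ z.support
  · have hc' : z (t c) ≠ t c := by
      rw [← mul_apply, ← h.eq, mul_apply]
      exact fun h => mem_support.1 hc (t.injective h)
    obtain ⟨i, hi⟩ := hz.exists_pow_eq (mem_support.1 hc) hc'
    have := pow_mul_apply_eq_of_commute (d := 1) (e := i) h (by simpa using hi.symm) (orderOf z)
    rw [one_mul, mul_comm i, pow_mul, pow_orderOf_eq_one, one_pow] at this
    exact this
  · exact pow_apply_eq_self_of_apply_eq_self (hfix c hc) _

/-- A permutation that inverts an odd prime cycle and is supported there is an involution with a
single fixed point on the support of the cycle. -/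
theorem cycleType_of_conj_eq_inv {x n : Perm α} {p : ℕ} (hp : p.Prime) (hp2 : p ≠ 2)
    (hc : x.IsCycle) (hx : x.support.card = p) (hn : n * x * n⁻¹ = x⁻¹)
    (hfix : ∀ c ∉ x.support, n c = c) :
    n.cycleType = Multiset.replicate ((p - 1) / 2) 2 := by
  have hxp : x ^ p = 1 := hx ▸ hc.orderOf ▸ pow_orderOf_eq_one x
  have hconj (k : ℤ) : n * x ^ k = x ^ (-k) * n := by
    rw [zpow_neg, ← inv_zpow, ← hn, conj_zpow]
    group
  have hsupp {c : α} (h : c ∈ x.support) : n c ∈ x.support := by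
    rw [mem_support] at h ⊢
    intro h2
    have h3 : n (x c) = x⁻¹ (n c) := by
      have := congrArg (fun f : Perm α => f c) (hconj 1)
      simpa using this
    rw [Perm.inv_eq_iff_eq.2 h2.symm] at h3
    exact h (n.injective h3)
  have hsq : n ^ 2 = 1 := by
    ext c
    by_cases h : c ∈ x.support
    · obtain ⟨r, hr⟩ := hc.exists_zpow_eq (mem_support.1 h) (mem_support.1 (hsupp h))
      rw [pow_two, mul_apply, ← hr, ← mul_apply, hconj, mul_apply, ← hr, ← mul_apply, ← zpow_add]
      simp
    · rw [pow_two, mul_apply, hfix c h, hfix c h, one_apply]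
  -- If c and x ^ k c are both fixed, inversion gives x ^ (2k) c = c, so p divides k because p is
  -- odd.
  have hone : (x.support \ n.support).card ≤ 1 := by
    rw [Finset.card_le_one]
    intro c hcx d hdx
    simp only [Finset.mem_sdiff, notMem_support] at hcx hdx
    obtain ⟨k, hk⟩ := hc.exists_pow_eq (mem_support.1 hcx.1) (mem_support.1 hdx.1)
    have h1 : (x ^ (k : ℤ)) c = (x ^ (-(k : ℤ))) c := by
      conv_lhs => rw [zpow_natCast, hk, ← hdx.2, ← hk, ← zpow_natCast, ← mul_apply, hconj,
        mul_apply, hcx.2]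
    have h2 : (x ^ (2 * k)) c = c := by
      rw [two_mul, pow_add, mul_apply, ← zpow_natCast, h1, ← mul_apply, ← zpow_add]
      simp
    have h3 : p ∣ 2 * k := by
      rw [← hx, ← hc.orderOf, orderOf_dvd_iff_pow_eq_one]
      exact hc.pow_eq_one_iff.2 ⟨c, mem_support.1 hcx.1, h2⟩
    have h4 : p ∣ k := ((Nat.coprime_primes hp Nat.prime_two).2 hp2).dvd_of_dvd_mul_left h3
    obtain ⟨l, rfl⟩ := h4
    rw [← hk, pow_mul, hxp, one_pow, one_apply]
  have hsub : n.support ⊆ x.support := by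
    intro c hcn
    by_contra h
    exact mem_support.1 hcn (hfix c h)
  have hcard : x.support.card ≤ n.support.card + 1 := by
    have := Finset.card_sdiff_add_card_eq_card hsub
    omega
  have hle := Finset.card_le_card hsub
  have hp1 := hp.two_le
  have hodd := hp.eq_two_or_odd.resolve_left hp2
  have hn2 : orderOf n = 2 := orderOf_eq_prime hsq fun h => by
    rw [h, support_one, Finset.card_empty] at hcard
    omega
  obtain ⟨j, hj⟩ := cycleType_prime_order (σ := n) (hn2 ▸ Nat.prime_two)
  have hsum : n.support.card = (j + 1) * 2 := by
    rw [← sum_cycleType, hj, Multiset.sum_replicate, hn2, smul_eq_mul]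
  rw [hj, hn2]
  congr 1
  omega

/-- Such a group contains a Sylow p-subgroup of the whole symmetric group, and some conjugate of any
p-cycle lies in it. -/
theorem exists_isCycle_mem_of_pow_factorization_dvd {G : Subgroup (Perm α)} {p : ℕ} (hp : p.Prime)
    (hpα : p ≤ Nat.card α)
    (hG : p ^ (Nat.card α).factorial.factorization p ∣ Nat.card G) :
    ∃ g ∈ G, g.IsCycle ∧ g.support.card = p := by
  have := Fact.mk hp
  obtain ⟨K, hK⟩ := Sylow.exists_subgroup_card_pow_prime p hG
  let P : Sylow p (Perm α) := Sylow.ofCard (K.map G.subtype) (by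
    rw [Nat.card_perm, ← hK]
    exact Nat.card_congr (K.equivMapOfInjective _ G.subtype_injective).symm.toEquiv)
  obtain ⟨τ, hτ⟩ : ∃ τ : Perm α, τ.cycleType = {p} := by
    rw [exists_with_cycleType_iff]
    simpa [hp.two_le, Nat.card_eq_fintype_card] using! hpα
  have hτc : τ.IsCycle := card_cycleType_eq_one.1 (by rw [hτ, Multiset.card_singleton])
  have hτp : τ.support.card = p := by rw [← sum_cycleType, hτ, Multiset.sum_singleton]
  have hτP : IsPGroup p (Subgroup.zpowers τ) := by
    refine IsPGroup.of_card (n := 1) ?_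
    rw [Nat.card_zpowers, hτc.orderOf, hτp, pow_one]
  obtain ⟨Q, hQ⟩ := hτP.exists_le_sylow
  obtain ⟨h, hh⟩ := exists_smul_eq (Perm α) Q P
  refine ⟨h * τ * h⁻¹, ?_, hτc.conj, by rw [card_support_conj, hτp]⟩
  have h1 : h * τ * h⁻¹ ∈ h • Q := by
    rw [Sylow.smul_def]
    exact Subgroup.smul_mem_pointwise_smul τ (MulAut.conj h) _ (hQ (Subgroup.mem_zpowers τ))
  rw [hh] at h1
  obtain ⟨k, -, hk⟩ := h1
  rw [← hk]
  exact k.2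

end Equiv.Perm

/-- Conjugation by n is x ↦ x ^ j, and the multiplicative order of j modulo p divides both p - 1 and
`orderOf n`; so j² = 1 in the field `ZMod p`. -/
theorem conj_eq_self_or_inv_of_gcd_dvd_two {S : Type*} [Group S] {p : ℕ} [Fact p.Prime] {x n : S}
    (hx : orderOf x = p) (hn : n * x * n⁻¹ ∈ Subgroup.zpowers x)
    (hgcd : Nat.gcd (p - 1) (orderOf n) ∣ 2) :
    n * x * n⁻¹ = x ∨ n * x * n⁻¹ = x⁻¹ := by
  have hp : p.Prime := Fact.out
  obtain ⟨j, hj⟩ := hn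
  simp only at hj
  have hiter (k : ℕ) : n ^ k * x * (n ^ k)⁻¹ = x ^ (j ^ k) := by
    induction k with
    | zero => simp
    | succ k ih =>
      rw [pow_succ', mul_inv_rev, show n * n ^ k * x * ((n ^ k)⁻¹ * n⁻¹) =
        n * (n ^ k * x * (n ^ k)⁻¹) * n⁻¹ by group, ih, ← conj_zpow, ← hj, ← zpow_mul, pow_succ,
        mul_comm]
  have heq {a b : ℤ} : x ^ a = x ^ b ↔ (a : ZMod p) = b := by
    rw [zpow_eq_zpow_iff_modEq, hx, ZMod.intCast_eq_intCast_iff]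
  have h1 : ((j : ZMod p)) ^ orderOf n = 1 := by
    have := hiter (orderOf n)
    rw [pow_orderOf_eq_one, one_mul, inv_one, mul_one] at this
    have h2 : x ^ (1 : ℤ) = x ^ (j ^ orderOf n) := by rw [zpow_one]; exact this
    simpa using (heq.1 h2).symm
  have h0 : (j : ZMod p) ≠ 0 := by
    intro h
    rw [h, zero_pow (orderOf_pos_iff.2 ?_).ne'] at h1
    · exact zero_ne_one h1
    -- Here `orderOf n = 0` means infinite order; j ≡ 0 would still force n x n⁻¹ = 1.
    · rw [← orderOf_pos_iff, Nat.pos_iff_ne_zero]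
      intro h3
      rw [h3, Nat.gcd_zero_right] at hgcd
      have h5 : x ^ j = x ^ (0 : ℤ) := heq.2 (by simpa using h)
      rw [hj, zpow_zero, conj_eq_one_iff] at h5
      rw [h5, orderOf_one] at hx
      exact hp.ne_one hx.symm
  have h2 : ((j : ZMod p)) ^ 2 = 1 := by
    rw [← orderOf_dvd_iff_pow_eq_one]
    exact (Nat.dvd_gcd (orderOf_dvd_of_pow_eq_one (ZMod.pow_card_sub_one_eq_one h0))
      (orderOf_dvd_of_pow_eq_one h1)).trans hgcd
  rw [← hj]
  rcases (sq_eq_sq_iff_eq_or_eq_neg (b := (1 : ZMod p))).1 (by rw [h2, one_pow]) with h | h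
  · left
    exact ((heq (b := 1)).2 (by simpa using h)).trans (zpow_one x)
  · right
    exact ((heq (b := -1)).2 (by simpa using h)).trans (zpow_neg_one x)

namespace Equiv.Perm

theorem descFactorial_dvd_card_of_isMultiplyPretransitive {G α : Type*} [Group G] [Finite α]
    [MulAction G α] {k : ℕ} (h : IsMultiplyPretransitive G α k) (hk : k ≤ Nat.card α) :
    (Nat.card α).descFactorial k ∣ Nat.card G := by
  obtain ⟨s, -, hs⟩ := Set.exists_subset_card_eq (s := (_root_.Set.univ : Set α)) (n := k)
    (by rwa [Set.ncard_univ])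
  have h1 := IsMultiplyPretransitive.index_of_fixingSubgroup_eq (G := G) s (by rwa [hs])
  rw [hs, mul_comm, ← Nat.descFactorial_eq_factorial_mul_choose] at h1
  rw [← h1]
  exact Subgroup.index_dvd_card _

variable {α : Type*} [Fintype α] [DecidableEq α]

/-- An element of order 5 has one or two 5-cycles. One is settled by Jordan. With two, either 25,
the full 5-part of 13!, divides the order and a 5-cycle exists, or the centralizer argument applies
to the three fixed points. -/
theorem alternatingGroup_le_of_card_eq_thirteen_of_five_dvd {G : Subgroup (Perm α)}
    (hG : IsPreprimitive G α) (hα : Nat.card α = 13) (h3 : IsMultiplyPretransitive G α 3)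
    (h5 : 5 ∣ Nat.card G) : alternatingGroup α ≤ G := by
  have hcycle {g : Perm α} (hg : g ∈ G) (hc : g.IsCycle) (h : g.support.card = 5) :
      alternatingGroup α ≤ G :=
    alternatingGroup_le_of_isPreprimitive_of_isCycle_mem hG hg hc (h ▸ Nat.prime_five) (by omega)
  have := Fact.mk Nat.prime_five
  obtain ⟨u, hu⟩ := exists_prime_orderOf_dvd_card' 5 h5
  rw [← Subgroup.orderOf_coe] at hu
  obtain ⟨n, hn⟩ := card_support_eq_mul_of_prime_order Nat.prime_five hu
  have hle : (u : Perm α).support.card ≤ 13 :=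
    hα ▸ Nat.card_eq_fintype_card (α := α) ▸ Finset.card_le_univ _
  obtain rfl | rfl : n = 0 ∨ n = 1 := by omega
  · obtain ⟨hc, h⟩ := isCycle_and_card_support_of_card_support_lt Nat.prime_five hu (by omega)
    exact hcycle u.2 hc h
  by_cases h25 : 5 ^ 2 ∣ Nat.card G
  · obtain ⟨g, hg, hc, h⟩ := exists_isCycle_mem_of_pow_factorization_dvd (G := G) Nat.prime_five
      (by omega) (by
        rw [hα]
        refine (pow_dvd_pow 5 (Nat.le_of_lt_succ ?_)).trans h25
        by_contra hlt
        have := (Nat.prime_five.pow_dvd_iff_le_factorization (Nat.factorial_ne_zero 13)).2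
          (not_lt.1 hlt)
        norm_num [Nat.factorial] at this)
    exact hcycle hg hc h
  · have hF : (u : Perm α).supportᶜ.card = 3 := by
      rw [Finset.card_compl, ← Nat.card_eq_fintype_card]
      omega
    obtain ⟨g, hg, h⟩ := exists_isThreeCycle_mem_of_isMultiplyPretransitive u.2 Nat.prime_five
      (by norm_num) hu (by omega) (by omega) (by rwa [hF])
      (fun h => h25 (h.trans (Subgroup.card_dvd_of_le inf_le_left)))
    exact alternatingGroup_le_of_isPreprimitive_of_isThreeCycle_mem hG h hg

/-- If 5 does not divide the order, an element normalizing ⟨x⟩ can only centralize or invert x; in a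
point stabilizer inverting is an odd permutation. Transfer then gives a nontrivial 2-element
commuting with an 11-cycle, but it must fix both remaining points and so has order dividing 11. -/
theorem five_dvd_card_of_card_eq_thirteen {G : Subgroup (Perm α)}
    (hα : Nat.card α = 13) (h3 : IsMultiplyPretransitive G α 3) (hGA : G ≤ alternatingGroup α)
    {x : Perm α} (hxG : x ∈ G) (hx : orderOf x = 11) : 5 ∣ Nat.card G := by
  by_contra h5
  have hp : Nat.Prime 11 := by norm_num
  have := Fact.mk hp
  have hcyc {z : Perm α} (hz : orderOf z = 11) : z.IsCycle ∧ z.support.card = 11 ∧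
      z.supportᶜ.card = 2 := by
    obtain ⟨h1, h2⟩ := isCycle_and_card_support_of_card_lt hp hz (by omega)
    refine ⟨h1, h2, ?_⟩
    rw [Finset.card_compl, ← Nat.card_eq_fintype_card]
    omega
  obtain ⟨hxc, hxs, hxF⟩ := hcyc hx
  obtain ⟨a, ha⟩ : x.supportᶜ.Nonempty := Finset.card_pos.1 (by omega)
  rw [Finset.mem_compl] at ha
  -- Fixing a forces normalizing elements to fix the other fixed point of x too; otherwise a swap of
  -- the two could make an inverting element even.
  let S : Subgroup (Perm α) := G ⊓ stabilizer (Perm α) a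
  have hSa {g : Perm α} (hg : g ∈ S) : g a = a := hg.2
  have hxS : x ∈ S := ⟨hxG, notMem_support.1 ha⟩
  have hGcard : 2 * Nat.card G ∣ 13 * (12 * (11 * Nat.factorial 10)) := by
    have h1 : Nontrivial α := Finite.one_lt_card_iff_nontrivial.1 (by omega)
    have h2 := two_mul_nat_card_alternatingGroup (α := α)
    rw [Nat.card_perm, hα] at h2
    have h3 : 13 * (12 * (11 * Nat.factorial 10)) = Nat.factorial 13 := rfl
    rw [h3, ← h2]
    exact Nat.mul_dvd_mul_left 2 (Subgroup.card_dvd_of_le hGA)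
  have hScard : 2 * Nat.card S ∣ 13 * (12 * (11 * Nat.factorial 10)) :=
    (Nat.mul_dvd_mul_left 2 (Subgroup.card_dvd_of_le inf_le_left)).trans hGcard
  have hfac : (Nat.card S).factorization 11 = 1 := by
    refine le_antisymm ?_ ?_
    · by_contra h
      have h1 := (hp.pow_dvd_iff_le_factorization Nat.card_pos.ne').2
        (show 2 ≤ (Nat.card S).factorization 11 by omega)
      have h2 := (Dvd.dvd.mul_left h1 2).trans hScard
      norm_num [Nat.factorial] at h2
    · refine (hp.dvd_iff_one_le_factorization Nat.card_pos.ne').1 ?_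
      have := orderOf_dvd_natCard (⟨x, hxS⟩ : S)
      rwa [Subgroup.orderOf_mk, hx] at this
  let P : Sylow 11 S := Sylow.ofCard (Subgroup.zpowers ⟨x, hxS⟩)
    (by rw [Nat.card_zpowers, Subgroup.orderOf_mk, hx, hfac, pow_one])
  have hPc : Nat.card P = 11 := by
    change Nat.card (Subgroup.zpowers (⟨x, hxS⟩ : S)) = 11
    rw [Nat.card_zpowers, Subgroup.orderOf_mk, hx]
  have hcent (n : S) (hn : n * ⟨x, hxS⟩ * n⁻¹ ∈ Subgroup.zpowers (⟨x, hxS⟩ : S)) :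
      n * ⟨x, hxS⟩ * n⁻¹ = ⟨x, hxS⟩ := by
    refine (conj_eq_self_or_inv_of_gcd_dvd_two (p := 11) (by rw [Subgroup.orderOf_mk, hx]) hn
      ?_).resolve_right ?_
    · have h1 : Nat.Coprime (Nat.gcd 10 (orderOf n)) 5 := by
        rw [Nat.coprime_comm, Nat.prime_five.coprime_iff_not_dvd]
        intro h
        exact h5 (((h.trans (Nat.gcd_dvd_right _ _)).trans (orderOf_dvd_natCard n)).trans
          (Subgroup.card_dvd_of_le inf_le_left))
      exact h1.dvd_of_dvd_mul_right (show Nat.gcd 10 (orderOf n) ∣ 2 * 5 from Nat.gcd_dvd_left _ _)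
    · intro hinv
      have hinv' : (n : Perm α) * x * (n : Perm α)⁻¹ = x⁻¹ := by
        simpa using congrArg Subtype.val hinv
      have hfix := apply_eq_self_of_card_compl_support_eq_two hxF ha (hSa n.2) (fun c hc => by
        rw [notMem_support] at hc ⊢
        have h1 : (n : Perm α) (x c) = x⁻¹ ((n : Perm α) c) := by
          rw [← mul_apply, ← mul_apply, ← hinv', inv_mul_cancel_right]
        rw [hc] at h1
        exact (Perm.inv_eq_iff_eq.1 h1.symm).symm)
      -- Five transpositions: an odd permutation.
      have htype := cycleType_of_conj_eq_inv hp (by norm_num) hxc hxs hinv' hfix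
      have hsign := mem_alternatingGroup.1 (hGA n.2.1)
      rw [sign_of_cycleType, htype] at hsign
      revert hsign
      simp
      decide
  have hP : Subgroup.normalizer P ≤ Subgroup.centralizer (P : Set S) := by
    intro n hn
    have h1 : n * ⟨x, hxS⟩ * n⁻¹ ∈ Subgroup.zpowers (⟨x, hxS⟩ : S) :=
      (Subgroup.mem_normalizer_iff.1 hn _).1 (Subgroup.mem_zpowers _)
    have h2 : Commute n ⟨x, hxS⟩ := mul_inv_eq_iff_eq_mul.1 (hcent n h1)
    rw [Subgroup.mem_centralizer_iff]
    rintro _ ⟨k, rfl⟩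
    exact ((h2.zpow_right k).eq).symm
  have h2S : 2 ∣ Nat.card S := by
    have h2 : IsMultiplyPretransitive G α 2 :=
      isMultiplyPretransitive_of_le (n := 3) (by omega) (by omega)
    have htrans : IsPretransitive G α := isPretransitive_of_is_two_pretransitive
    have hdvd := descFactorial_dvd_card_of_isMultiplyPretransitive (k := 2) h2 (by omega)
    rw [hα] at hdvd
    have hS : S = (stabilizer G a).map G.subtype := by
      ext g
      simp only [S, Subgroup.mem_inf, Subgroup.mem_map, Subgroup.subtype_apply]
      exact ⟨fun h => ⟨⟨g, h.1⟩, h.2, rfl⟩, by rintro ⟨g, h, rfl⟩; exact ⟨g.2, h⟩⟩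
    rw [hS, Subgroup.card_map_of_injective G.subtype_injective]
    have hidx := (stabilizer G a).card_mul_index
    rw [index_stabilizer_of_transitive, hα] at hidx
    have h4 : 2 ∣ Nat.card (stabilizer G a) * 13 := by
      rw [hidx]
      exact (by norm_num [Nat.descFactorial] : 2 ∣ Nat.descFactorial 13 2).trans hdvd
    exact Nat.Coprime.dvd_of_dvd_mul_right (by norm_num) h4
  have := Fact.mk Nat.prime_two
  obtain ⟨z, t, hz, ht1, ⟨k, hk⟩, htz⟩ := exists_commute_of_normalizer_le_centralizer
    (p := 11) (r := 2) (by norm_num) P hPc hP h2S (fun i hi hdvd hmod => by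
      -- The 2-part of 13!/2 is 2 ^ 9, while 2 has order 10 modulo 11.
      have hi9 : i < 10 := by
        by_contra h
        have h1 := (Nat.mul_dvd_mul_left 2 ((pow_dvd_pow 2 (not_lt.1 h)).trans hdvd)).trans hScard
        norm_num [Nat.factorial] at h1
      interval_cases i <;> norm_num [Nat.ModEq] at hmod)
  rw [← Subgroup.orderOf_coe] at hz
  obtain ⟨hzc, hzs, hzF⟩ := hcyc hz
  have htz' : Commute (t : Perm α) z := by
    simpa using htz.map S.subtype
  have hza : a ∉ (z : Perm α).support := notMem_support.2 (hSa z.2)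
  have hfix := apply_eq_self_of_card_compl_support_eq_two hzF hza (hSa t.2) (fun c hc => by
    rw [notMem_support] at hc ⊢
    rw [← mul_apply, ← htz'.eq, mul_apply, hc])
  have h11 := pow_orderOf_eq_one_of_commute htz' hzc hfix
  rw [hz] at h11
  refine ht1 (orderOf_eq_one_iff.1 ?_)
  have h1 : orderOf t ∣ 11 := orderOf_dvd_of_pow_eq_one (Subtype.ext (by simpa using h11))
  have h2 : orderOf t ∣ 2 ^ k := orderOf_dvd_of_pow_eq_one hk
  have h3 : Nat.Coprime 11 (2 ^ k) := Nat.Coprime.pow_right k (by norm_num)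
  exact Nat.eq_one_of_dvd_coprimes h3 h1 h2

theorem alternatingGroup_le_of_card_eq_thirteen {G : Subgroup (Perm α)}
    (hG : IsPreprimitive G α) (hα : Nat.card α = 13) (hGA : G ≤ alternatingGroup α)
    {x : Perm α} (hxG : x ∈ G) (hx : orderOf x = 11) : alternatingGroup α ≤ G := by
  have hp : Nat.Prime 11 := by norm_num
  obtain ⟨h1, h2⟩ := isCycle_and_card_support_of_card_lt hp hx (by omega)
  have h3 : IsMultiplyPretransitive G α 3 :=
    isMultiplyPretransitive_of_isCycle_mem hG hxG h1 (h2 ▸ hp) (k := 1) (by omega)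
  exact alternatingGroup_le_of_card_eq_thirteen_of_five_dvd hG hα h3
    (five_dvd_card_of_card_eq_thirteen hα h3 hGA hxG hx)

end Equiv.Perm

/-! ### Subgroups of small index in alternating groups -/

/-- A group of order `2 * k` with `k` odd is not generated by two elements of odd order. -/
theorem closure_pair_ne_top_of_card_eq_two_mul_odd {H : Type*} [Group H] [Finite H] {k : ℕ}
    (hk : Odd k) (hH : Nat.card H = 2 * k) {x y : H} (hx : Odd (orderOf x))
    (hy : Odd (orderOf y)) : Subgroup.closure {x, y} ≠ ⊤ := by
  intro htop
  have := Fact.mk Nat.prime_two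
  have hmin : (Nat.card H).minFac = 2 := by
    rw [Nat.minFac_eq_two_iff, hH]
    exact dvd_mul_right 2 k
  let P : Sylow 2 H := default
  have hfac : (Nat.card H).factorization 2 = 1 := by
    rw [hH, Nat.factorization_mul two_ne_zero hk.pos.ne', Finsupp.add_apply,
      Nat.Prime.factorization_self Nat.prime_two,
      Nat.factorization_eq_zero_of_not_dvd (by rw [← even_iff_two_dvd]; exact Nat.not_even_iff_odd.2 hk)]
  have hPc : Nat.card P = 2 := by
    rw [P.card_eq_multiplicity, hfac, pow_one]
  have hP : IsCyclic P := isCyclic_of_prime_card hPc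
  let f := MonoidHom.transferSylow P (hP.normalizer_le_centralizer hmin)
  have hc : f.ker.IsComplement' P := hP.isComplement' hmin
  have hodd {z : H} (hz : Odd (orderOf z)) : z ∈ f.ker := by
    rw [MonoidHom.mem_ker, ← orderOf_eq_one_iff]
    refine Nat.eq_one_of_dvd_coprimes (a := orderOf z) (b := 2) ?_ (orderOf_map_dvd f z)
      ((orderOf_dvd_natCard (f z)).trans hPc.dvd)
    exact Nat.coprime_two_right.2 hz
  have hker : f.ker = ⊤ := by
    rw [← top_le_iff, ← htop, Subgroup.closure_le]
    rintro z (rfl | rfl)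
    · exact hodd hx
    · exact hodd hy
  have hmul := hc.card_mul_card
  rw [hker, Subgroup.card_top, hPc] at hmul
  have := Nat.card_pos (α := H)
  omega

theorem IsSimpleGroup.toPermHom_quotient_injective {A : Type*} [Group A] [IsSimpleGroup A]
    {H : Subgroup A} (hH : H ≠ ⊤) : Function.Injective (MulAction.toPermHom A (A ⧸ H)) := by
  rw [← MonoidHom.ker_eq_bot_iff, ← Subgroup.normalCore_eq_ker]
  exact (H.normalCore_normal.eq_bot_or_eq_top).resolve_right fun h =>
    hH (top_le_iff.1 (h ▸ H.normalCore_le))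

theorem IsSimpleGroup.card_dvd_factorial_index {A : Type*} [Group A] [Finite A] [IsSimpleGroup A]
    {H : Subgroup A} (hH : H ≠ ⊤) : Nat.card A ∣ H.index.factorial := by
  have := Subgroup.card_dvd_of_injective _ (IsSimpleGroup.toPermHom_quotient_injective hH)
  rwa [Nat.card_perm] at this

namespace alternatingGroup

variable {α : Type*} [Fintype α] [DecidableEq α]

theorem nonempty_mulEquiv_fin {n : ℕ} (h : Nat.card α = n) :
    Nonempty (alternatingGroup α ≃* alternatingGroup (Fin n)) := by
  rw [Nat.card_eq_fintype_card] at h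
  exact ⟨Equiv.altCongrHom (Fintype.equivFinOfCardEq h)⟩

/-- A subgroup of index `n` of the alternating group of degree `n ≥ 5` is isomorphic to the
alternating group of degree `n - 1`, even if it is not a point stabilizer. -/
theorem nonempty_mulEquiv_of_index_eq_card (hα : 5 ≤ Nat.card α) {H : Subgroup (alternatingGroup α)}
    (hH : H.index = Nat.card α) :
    Nonempty (H ≃* alternatingGroup (Fin (Nat.card α - 1))) := by
  classical
  have := isSimpleGroup hα
  have : Nontrivial α := Finite.one_lt_card_iff_nontrivial.1 (by omega)
  have htop : H ≠ ⊤ := by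
    rintro rfl
    rw [Subgroup.index_top] at hH
    omega
  let Ω := alternatingGroup α ⧸ H
  have : Fintype Ω := Fintype.ofFinite Ω
  have hΩ : Nat.card Ω = Nat.card α := hH
  have : Nontrivial Ω := Finite.one_lt_card_iff_nontrivial.1 (by omega)
  let φ : alternatingGroup α →* Perm Ω := MulAction.toPermHom (alternatingGroup α) Ω
  have hφ : Function.Injective φ := IsSimpleGroup.toPermHom_quotient_injective htop
  -- The coset action is faithful by simplicity, so its image has index 2; `H` becomes the
  -- stabilizer of the trivial coset.
  have hrange : φ.range = alternatingGroup Ω := by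
    apply eq_alternatingGroup_of_index_eq_two
    have h1 := φ.range.card_mul_index
    rw [← Nat.card_congr (MonoidHom.ofInjective hφ).toEquiv, Nat.card_perm, hΩ,
      ← Nat.card_perm, ← two_mul_nat_card_alternatingGroup, mul_comm] at h1
    exact Nat.eq_of_mul_eq_mul_right Nat.card_pos h1
  let ψ : alternatingGroup α ≃* alternatingGroup Ω :=
    (MonoidHom.ofInjective hφ).trans (MulEquiv.subgroupCongr hrange)
  let s : Finset Ω := Finset.univ.erase ((1 : alternatingGroup α) : Ω)
  have hs : Nat.card s = Nat.card α - 1 := by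
    rw [← hΩ, Nat.card_eq_fintype_card, Fintype.card_coe, Finset.card_erase_of_mem (Finset.mem_univ _),
      Finset.card_univ, Nat.card_eq_fintype_card]
  have hmap : H.map ψ.toMonoidHom = (ofSubtype s).range := by
    ext k
    obtain ⟨g, rfl⟩ := ψ.surjective k
    have h1 : ψ g ∈ H.map ψ.toMonoidHom ↔ g ∈ H :=
      Subgroup.mem_map_iff_mem (f := ψ.toMonoidHom) ψ.injective
    rw [h1, mem_range_ofSubtype_iff]
    have h2 : ((ψ g : alternatingGroup Ω) : Perm Ω) ((1 : alternatingGroup α) : Ω) = (g : Ω) := by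
      change g • ((1 : alternatingGroup α) : Ω) = (g : Ω)
      rw [MulAction.Quotient.smul_coe, smul_eq_mul, mul_one]
    have h3 : g ∈ H ↔ (g : Ω) = ((1 : alternatingGroup α) : Ω) := by
      rw [eq_comm, QuotientGroup.eq, inv_one, one_mul]
    rw [h3, ← h2]
    constructor
    · intro h c hc
      refine Finset.mem_erase.2 ⟨?_, Finset.mem_univ _⟩
      rintro rfl
      exact mem_support.1 hc h
    · intro h
      by_contra hne
      exact absurd (h (mem_support.2 hne)) (Finset.notMem_erase _ _)
  obtain ⟨e⟩ := nonempty_mulEquiv_fin hs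
  exact ⟨(H.equivMapOfInjective ψ.toMonoidHom ψ.injective).trans <|
    (MulEquiv.subgroupCongr hmap).trans <|
    (MonoidHom.ofInjective ofSubtype_injective).symm.trans e⟩

theorem not_isSolvable_of_five_le (hα : 5 ≤ Nat.card α) :
    ¬ Group.IsSolvable (alternatingGroup α) := by
  have := isSimpleGroup hα
  rw [← IsSimpleGroup.comm_iff_isSolvable]
  intro h
  have h1 : IsMulCommutative (alternatingGroup α) := ⟨⟨h⟩⟩
  have := isMulCommutative_iff_card_le_three.1 h1
  omega

/-- Two elements of an alternating group may be viewed in the alternating group on the union of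
their supports. -/
theorem exists_closure_pair_mulEquiv (x y : alternatingGroup α) :
    ∃ (s : Finset α) (x' y' : alternatingGroup s), orderOf x' = orderOf x ∧ orderOf y' = orderOf y ∧
      (x' : Perm s).support ∪ (y' : Perm s).support = Finset.univ ∧
      Nonempty (Subgroup.closure {x, y} ≃* Subgroup.closure {x', y'}) := by
  let s := (x : Perm α).support ∪ (y : Perm α).support
  obtain ⟨x', hx'⟩ := (mem_range_ofSubtype_iff s x).2 Finset.subset_union_left
  obtain ⟨y', hy'⟩ := (mem_range_ofSubtype_iff s y).2 Finset.subset_union_right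
  refine ⟨s, x', y', ?_, ?_, ?_, ?_⟩
  · rw [← hx', orderOf_injective _ ofSubtype_injective]
  · rw [← hy', orderOf_injective _ ofSubtype_injective]
  · ext ⟨a, ha⟩
    have happ (z : alternatingGroup s) :
        ((ofSubtype s z : alternatingGroup α) : Perm α) a = (z : Perm s) ⟨a, ha⟩ :=
      Perm.ofSubtype_apply_of_mem _ ha
    simp only [s, Finset.mem_union, mem_support] at ha
    rw [← hx', ← hy', happ, happ] at ha
    simpa [mem_support, Subtype.ext_iff] using ha
  · have h : Subgroup.closure {x, y} = (Subgroup.closure {x', y'}).map (ofSubtype s) := by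
      rw [MonoidHom.map_closure, Set.image_pair, hx', hy']
    exact ⟨(MulEquiv.subgroupCongr h).trans
      (Subgroup.equivMapOfInjective _ _ ofSubtype_injective).symm⟩

theorem map_subtype_closure_pair (x y : alternatingGroup α) :
    (Subgroup.closure {x, y}).map (alternatingGroup α).subtype =
      Subgroup.closure {(x : Perm α), (y : Perm α)} := by
  rw [MonoidHom.map_closure, Set.image_pair]
  rfl

theorem closure_pair_le (x y : alternatingGroup α) :
    Subgroup.closure {(x : Perm α), (y : Perm α)} ≤ alternatingGroup α := by
  rw [← map_subtype_closure_pair]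
  exact Subgroup.map_subtype_le _

theorem closure_pair_eq_top {x y : alternatingGroup α}
    (h : alternatingGroup α ≤ Subgroup.closure {(x : Perm α), (y : Perm α)}) :
    Subgroup.closure {x, y} = ⊤ := by
  rw [← map_subtype_closure_pair] at h
  rw [← top_le_iff]
  intro g _
  exact (Subgroup.mem_map_iff_mem (alternatingGroup α).subtype_injective).1 (h g.2)

theorem card_closure_pair (x y : alternatingGroup α) :
    Nat.card (Subgroup.closure {(x : Perm α), (y : Perm α)}) =
      Nat.card (Subgroup.closure {x, y}) := by
  rw [← map_subtype_closure_pair, Subgroup.card_map_of_injective (Subgroup.subtype_injective _)]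

theorem card_closure_pair_ne_two_mul_odd {A : Type*} [Group A] [Finite A] {x y : A}
    (hx : Odd (orderOf x)) (hy : Odd (orderOf y)) {k : ℕ} (hk : Odd k) :
    Nat.card (Subgroup.closure {x, y}) ≠ 2 * k := by
  intro h
  have hxm : x ∈ Subgroup.closure {x, y} := Subgroup.subset_closure (by simp)
  have hym : y ∈ Subgroup.closure {x, y} := Subgroup.subset_closure (by simp)
  refine closure_pair_ne_top_of_card_eq_two_mul_odd hk h (x := ⟨x, hxm⟩) (y := ⟨y, hym⟩)
    (by rwa [Subgroup.orderOf_mk]) (by rwa [Subgroup.orderOf_mk]) ?_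
  convert! Subgroup.closure_closure_coe_preimage (k := ({x, y} : Set A)) using 2
  ext ⟨z, hz⟩
  simp [Subtype.ext_iff]

/-- A proper index i divides 2520/210 = 12, and simplicity gives 2520 ∣ i!, so i = 12. Order 210 = 2
· 105 is impossible for a group generated by two elements of odd order. -/
theorem closure_pair_eq_top_of_card_eq_seven (hα : Nat.card α = 7) {x y : alternatingGroup α}
    (hx : Odd (orderOf x)) (hy : Odd (orderOf y))
    (h : 210 ∣ Nat.card (Subgroup.closure {x, y})) : Subgroup.closure {x, y} = ⊤ := by
  by_contra htop
  have := isSimpleGroup (α := α) (by omega)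
  have : Nontrivial α := Finite.one_lt_card_iff_nontrivial.1 (by omega)
  have h1 := IsSimpleGroup.card_dvd_factorial_index htop
  have h2 := (Subgroup.closure {x, y}).card_mul_index
  have h3 := two_mul_nat_card_alternatingGroup (α := α)
  rw [Nat.card_perm, hα, show Nat.factorial 7 = 2 * 2520 by rfl] at h3
  have h4 : Nat.card (alternatingGroup α) = 2520 := by omega
  rw [h4] at h1 h2
  obtain ⟨c, hc⟩ := h
  have hodd := card_closure_pair_ne_two_mul_odd hx hy (k := 105) (by decide)
  rw [hc] at h2 hodd
  have h5 : c * (Subgroup.closure {x, y}).index = 12 := by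
    rw [mul_assoc] at h2
    omega
  generalize (Subgroup.closure {x, y}).index = i at *
  have h6 : i ∣ 12 := ⟨c, by rw [← h5, mul_comm]⟩
  have h7 : i ≤ 12 := Nat.le_of_dvd (by norm_num) h6
  interval_cases i <;> first | omega | (norm_num [Nat.factorial] at h1)

/-- As in degree 7: a proper index divides 12 and 360 ∣ i!, leaving 6 and 12; index 12 would give
order 30 = 2 · 15. -/
theorem closure_pair_eq_top_or_index_eq_six (hα : Nat.card α = 6) {x y : alternatingGroup α}
    (hx : Odd (orderOf x)) (hy : Odd (orderOf y))
    (h : 30 ∣ Nat.card (Subgroup.closure {x, y})) :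
    Subgroup.closure {x, y} = ⊤ ∨ (Subgroup.closure {x, y}).index = 6 := by
  refine or_iff_not_imp_left.2 fun htop => ?_
  have := isSimpleGroup (α := α) (by omega)
  have : Nontrivial α := Finite.one_lt_card_iff_nontrivial.1 (by omega)
  have h1 := IsSimpleGroup.card_dvd_factorial_index htop
  have h2 := (Subgroup.closure {x, y}).card_mul_index
  have h3 := two_mul_nat_card_alternatingGroup (α := α)
  rw [Nat.card_perm, hα, show Nat.factorial 6 = 2 * 360 by rfl] at h3
  have h4 : Nat.card (alternatingGroup α) = 360 := by omega
  rw [h4] at h1 h2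
  obtain ⟨c, hc⟩ := h
  have hodd := card_closure_pair_ne_two_mul_odd hx hy (k := 15) (by decide)
  rw [hc] at h2 hodd
  have h5 : c * (Subgroup.closure {x, y}).index = 12 := by
    rw [mul_assoc] at h2
    omega
  generalize (Subgroup.closure {x, y}).index = i at *
  have h6 : i ∣ 12 := ⟨c, by rw [← h5, mul_comm]⟩
  have h7 : i ≤ 12 := Nat.le_of_dvd (by norm_num) h6
  interval_cases i <;> first | rfl | omega | (norm_num [Nat.factorial] at h1)

end alternatingGroup

/-! ### Transitive generation and the choice of primes -/

namespace Equiv.Perm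

variable {α : Type*} [Fintype α] [DecidableEq α]

/-- A cycle and a permutation of prime order generate a transitive group if they have no common
fixed point and every nontrivial orbit of the latter must meet the support of the former. -/
theorem isPretransitive_closure_pair {x y : Perm α} {p : ℕ} (hp : p.Prime) (hx : orderOf x = p)
    (hy : y.IsCycle) (hcard : Nat.card α < p + y.support.card)
    (hcover : x.support ∪ y.support = Finset.univ) :
    IsPretransitive (Subgroup.closure {x, y}) α := by
  have hxm : x ∈ Subgroup.closure {x, y} := Subgroup.subset_closure (by simp)
  have hym : y ∈ Subgroup.closure {x, y} := Subgroup.subset_closure (by simp)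
  obtain ⟨b, hb, -⟩ := id hy
  rw [isPretransitive_iff_base b]
  have hsupp (c : α) (hc : y c ≠ c) : ∃ g : Subgroup.closure {x, y}, g • b = c := by
    obtain ⟨i, hi⟩ := hy.exists_pow_eq hb hc
    exact ⟨⟨y ^ i, Subgroup.pow_mem _ hym i⟩, hi⟩
  intro c
  by_cases hc : y c = c
  · have hcx : x c ≠ c := by
      have := hcover ▸ Finset.mem_univ c
      simpa [hc] using this
    -- An x-orbit avoiding the support of y would give p fixed points of y, too many for the degree.
    obtain ⟨i, hi⟩ : ∃ i : ℕ, y ((x ^ i) c) ≠ (x ^ i) c := by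
      by_contra! hall
      have hle : (Finset.univ : Finset (Fin p)).card ≤ y.supportᶜ.card := by
        refine Finset.card_le_card_of_injOn (fun i => (x ^ (i : ℕ)) c) ?_ ?_
        · intro i _
          simpa using hall i
        · intro i _ j _ hij
          exact Fin.ext (pow_apply_eq_pow_apply_of_prime hp (hx ▸ pow_orderOf_eq_one x) hcx
            i.2 j.2 hij)
      rw [Finset.card_univ, Fintype.card_fin, Finset.card_compl, ← Nat.card_eq_fintype_card] at hle
      have := hp.pos
      omega
    obtain ⟨g, hg⟩ := hsupp _ hi
    refine ⟨⟨x ^ i, Subgroup.pow_mem _ hxm i⟩⁻¹ * g, ?_⟩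
    rw [mul_smul, hg, inv_smul_eq_iff]
    rfl
  · exact hsupp c hc

end Equiv.Perm

namespace alternatingGroup

theorem nonempty_mulEquiv_fin_of_closure_pair_eq_top {α : Type*} [Fintype α] [DecidableEq α]
    {x y : alternatingGroup α} (hα : 5 ≤ Nat.card α) (h : Subgroup.closure {x, y} = ⊤) :
    ∃ d : ℕ, 5 ≤ d ∧ Nonempty (Subgroup.closure {x, y} ≃* alternatingGroup (Fin d)) := by
  obtain ⟨e⟩ := nonempty_mulEquiv_fin (α := α) rfl
  exact ⟨Nat.card α, hα, ⟨(MulEquiv.subgroupCongr h).trans (Subgroup.topEquiv.trans e)⟩⟩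

theorem orderOf_le_card {α : Type*} [Fintype α] {y : Perm α} {q : ℕ} (hq : q.Prime)
    (hy : orderOf y = q) : q ≤ Nat.card α := by
  have h : q ∣ (Nat.card α).factorial := by
    rw [← Nat.card_perm, ← hy]
    exact orderOf_dvd_natCard y
  exact (hq.dvd_factorial).1 h

variable {α : Type*} [Fintype α] [DecidableEq α] {x y : alternatingGroup α} {p q : ℕ}

theorem isPreprimitive_closure_pair (hp : p.Prime) (hq : q.Prime) (hpq : p < q)
    (hα : Nat.card α ≤ 2 * p) (hx : orderOf x = p) (hy : orderOf y = q)
    (hcover : (x : Perm α).support ∪ (y : Perm α).support = Finset.univ) :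
    IsPreprimitive (Subgroup.closure {(x : Perm α), (y : Perm α)}) α := by
  rw [← Subgroup.orderOf_coe] at hx hy
  obtain ⟨hc, hs⟩ := isCycle_and_card_support_of_card_lt hq hy (by omega)
  have := isPretransitive_closure_pair hp hx hc (by omega) hcover
  exact isPreprimitive_of_isCycle_mem (Subgroup.subset_closure (by simp)) hc (hs ▸ hq) (by omega)

theorem exists_mulEquiv_of_add_three_le (hp : p.Prime) (hq : q.Prime) (hpq : p < q) (hq5 : 5 ≤ q)
    (hα : Nat.card α ≤ 2 * p) (hx : orderOf x = p) (hy : orderOf y = q)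
    (hcover : (x : Perm α).support ∪ (y : Perm α).support = Finset.univ)
    (hx2 : (x : Perm α).support.card < 2 * p) (h3 : p = 3 ∨ p + 3 ≤ Nat.card α) :
    ∃ d : ℕ, 5 ≤ d ∧ Nonempty (Subgroup.closure {x, y} ≃* alternatingGroup (Fin d)) := by
  have hG := isPreprimitive_closure_pair hp hq hpq hα hx hy hcover
  rw [← Subgroup.orderOf_coe] at hx hy
  obtain ⟨hc, hs⟩ := isCycle_and_card_support_of_card_support_lt hp hx hx2
  have hxm : (x : Perm α) ∈ Subgroup.closure {(x : Perm α), (y : Perm α)} :=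
    Subgroup.subset_closure (by simp)
  refine nonempty_mulEquiv_fin_of_closure_pair_eq_top (hq5.trans (orderOf_le_card hq hy))
    (closure_pair_eq_top ?_)
  rcases h3 with rfl | h3
  · exact alternatingGroup_le_of_isPreprimitive_of_isThreeCycle_mem hG
      (card_support_eq_three_iff.1 hs) hxm
  · exact alternatingGroup_le_of_isPreprimitive_of_isCycle_mem hG hxm hc (hs ▸ hp) (by omega)

theorem exists_mulEquiv_of_orders_three_five (hα : Nat.card α ≤ 6) (hx : orderOf x = 3)
    (hy : orderOf y = 5)
    (hcover : (x : Perm α).support ∪ (y : Perm α).support = Finset.univ) :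
    ∃ d : ℕ, 5 ≤ d ∧ Nonempty (Subgroup.closure {x, y} ≃* alternatingGroup (Fin d)) := by
  by_cases hx2 : (x : Perm α).support.card < 2 * 3
  · exact exists_mulEquiv_of_add_three_le Nat.prime_three Nat.prime_five (by norm_num) le_rfl hα
      hx hy hcover hx2 (Or.inl rfl)
  have hle : (x : Perm α).support.card ≤ Nat.card α :=
    Nat.card_eq_fintype_card (α := α) ▸ Finset.card_le_univ _
  have hα6 : Nat.card α = 6 := by omega
  have hG := isPreprimitive_closure_pair Nat.prime_three Nat.prime_five (by norm_num) hα hx hy hcover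
  have h6 : 6 ∣ Nat.card (Subgroup.closure {x, y}) := by
    rw [← card_closure_pair]
    have h1 : IsMultiplyPretransitive (Subgroup.closure {(x : Perm α), (y : Perm α)}) α 1 :=
      is_one_pretransitive_iff.2 hG.toIsPretransitive
    have h2 := descFactorial_dvd_card_of_isMultiplyPretransitive h1 (by omega)
    rwa [hα6, Nat.descFactorial_one] at h2
  have h5 : 5 ∣ Nat.card (Subgroup.closure {x, y}) := by
    have := Subgroup.orderOf_dvd_natCard (Subgroup.closure {x, y}) (x := y)
      (Subgroup.subset_closure (by simp))
    rwa [hy] at this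
  have h30 : 30 ∣ Nat.card (Subgroup.closure {x, y}) :=
    Nat.Coprime.mul_dvd_of_dvd_of_dvd (by norm_num : Nat.Coprime 6 5) h6 h5
  rcases closure_pair_eq_top_or_index_eq_six hα6 (by rw [hx]; decide) (by rw [hy]; decide) h30
    with h | h
  · exact nonempty_mulEquiv_fin_of_closure_pair_eq_top (by omega) h
  -- The group is transitive on six points, hence no point stabilizer, yet index 6 makes it
  -- isomorphic to A_5.
  · obtain ⟨e⟩ := nonempty_mulEquiv_of_index_eq_card (by omega) (h.trans hα6.symm)
    exact ⟨_, by omega, ⟨e⟩⟩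

theorem exists_mulEquiv_of_orders_five_seven (hα : Nat.card α ≤ 10) (hx : orderOf x = 5)
    (hy : orderOf y = 7)
    (hcover : (x : Perm α).support ∪ (y : Perm α).support = Finset.univ) :
    ∃ d : ℕ, 5 ≤ d ∧ Nonempty (Subgroup.closure {x, y} ≃* alternatingGroup (Fin d)) := by
  have hp7 : Nat.Prime 7 := by norm_num
  have hle : (x : Perm α).support.card ≤ Nat.card α :=
    Nat.card_eq_fintype_card (α := α) ▸ Finset.card_le_univ _
  have hG := isPreprimitive_closure_pair Nat.prime_five hp7 (by norm_num) hα hx hy hcover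
  have h7 : 7 ≤ Nat.card α := orderOf_le_card hp7 (y := (y : Perm α)) (by rwa [Subgroup.orderOf_coe])
  by_cases hx2 : (x : Perm α).support.card < 2 * 5
  · rcases h7.eq_or_lt' with hα7 | hα7
    · obtain ⟨hc, hs⟩ := isCycle_and_card_support_of_card_support_lt Nat.prime_five
        (by rwa [Subgroup.orderOf_coe]) hx2
      have h3 := isMultiplyPretransitive_of_isCycle_mem hG (Subgroup.subset_closure (by simp)) hc
        (hs ▸ Nat.prime_five) (k := 1) (by omega)
      have h210 := descFactorial_dvd_card_of_isMultiplyPretransitive h3 (by omega)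
      rw [hα7, card_closure_pair] at h210
      exact nonempty_mulEquiv_fin_of_closure_pair_eq_top (by omega)
        (closure_pair_eq_top_of_card_eq_seven hα7 (by rw [hx]; decide) (by rw [hy]; decide) h210)
    · exact exists_mulEquiv_of_add_three_le Nat.prime_five hp7 (by norm_num) (by norm_num) hα
        hx hy hcover hx2 (Or.inr (by omega))
  -- Here x is a product of two 5-cycles in degree 10, so the 7-cycle y, with its three fixed
  -- points, takes over in Jordan's theorem.
  · obtain ⟨hc, hs⟩ := isCycle_and_card_support_of_card_lt (x := (y : Perm α)) hp7
      (by rwa [Subgroup.orderOf_coe]) (by omega)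
    refine nonempty_mulEquiv_fin_of_closure_pair_eq_top (by omega) (closure_pair_eq_top ?_)
    exact alternatingGroup_le_of_isPreprimitive_of_isCycle_mem hG
      (Subgroup.subset_closure (by simp)) hc (hs ▸ hp7) (by omega)

theorem exists_mulEquiv_of_orders_eleven_thirteen (hα : Nat.card α < 22) (hx : orderOf x = 11)
    (hy : orderOf y = 13)
    (hcover : (x : Perm α).support ∪ (y : Perm α).support = Finset.univ) :
    ∃ d : ℕ, 5 ≤ d ∧ Nonempty (Subgroup.closure {x, y} ≃* alternatingGroup (Fin d)) := by
  have hp11 : Nat.Prime 11 := by norm_num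
  have hp13 : Nat.Prime 13 := by norm_num
  have hle : (x : Perm α).support.card ≤ Nat.card α :=
    Nat.card_eq_fintype_card (α := α) ▸ Finset.card_le_univ _
  have h13 : 13 ≤ Nat.card α :=
    orderOf_le_card hp13 (y := (y : Perm α)) (by rwa [Subgroup.orderOf_coe])
  rcases h13.eq_or_lt' with hα13 | hα13
  · have hG := isPreprimitive_closure_pair hp11 hp13 (by norm_num) hα.le hx hy hcover
    refine nonempty_mulEquiv_fin_of_closure_pair_eq_top (by omega) (closure_pair_eq_top ?_)
    exact alternatingGroup_le_of_card_eq_thirteen hG hα13 (closure_pair_le x y)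
      (Subgroup.subset_closure (Set.mem_insert _ _)) (by rwa [Subgroup.orderOf_coe])
  · exact exists_mulEquiv_of_add_three_le hp11 hp13 (by norm_num) (by norm_num) hα.le
      hx hy hcover (by omega) (Or.inr (by omega))

end alternatingGroup

/-- A choice of two primes in the upper half of `[1, m]`, for which any two elements of these
orders that move all points generate an alternating group. -/
theorem exists_primes_forall_closure_pair_mulEquiv (m : ℕ) (hm : 5 ≤ m) :
    ∃ p q : ℕ, p.Prime ∧ q.Prime ∧ m ≤ 2 * p ∧ (m ≠ 6 → m ≠ 10 → m < 2 * p) ∧ p < q ∧ q ≤ m ∧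
      ∀ (α : Type) [Fintype α] [DecidableEq α] (x y : alternatingGroup α), Nat.card α ≤ m →
        orderOf x = p → orderOf y = q →
        (x : Perm α).support ∪ (y : Perm α).support = Finset.univ →
        ∃ d : ℕ, 5 ≤ d ∧ Nonempty (Subgroup.closure {x, y} ≃* alternatingGroup (Fin d)) := by
  have hgap (p q : ℕ) (hp : p.Prime) (hq : q.Prime) (h1 : m < 2 * p) (h2 : p + 3 ≤ q)
      (h3 : q ≤ m) : ∃ p q : ℕ, p.Prime ∧ q.Prime ∧ m ≤ 2 * p ∧ (m ≠ 6 → m ≠ 10 → m < 2 * p) ∧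
      p < q ∧ q ≤ m ∧
      ∀ (α : Type) [Fintype α] [DecidableEq α] (x y : alternatingGroup α), Nat.card α ≤ m →
        orderOf x = p → orderOf y = q →
        (x : Perm α).support ∪ (y : Perm α).support = Finset.univ →
        ∃ d : ℕ, 5 ≤ d ∧ Nonempty (Subgroup.closure {x, y} ≃* alternatingGroup (Fin d)) := by
    refine ⟨p, q, hp, hq, h1.le, fun _ _ => h1, by omega, h3, ?_⟩
    intro α _ _ x y hα hx hy hcover
    have hle : (x : Perm α).support.card ≤ Nat.card α :=
      Nat.card_eq_fintype_card (α := α) ▸ Finset.card_le_univ _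
    have hqα : q ≤ Nat.card α := alternatingGroup.orderOf_le_card hq (y := (y : Perm α))
      (by rwa [Subgroup.orderOf_coe])
    have := hp.two_le
    exact alternatingGroup.exists_mulEquiv_of_add_three_le hp hq (by omega) (by omega) (by omega)
      hx hy hcover (by omega) (Or.inr (by omega))
  by_cases h17 : 17 ≤ m
  · obtain ⟨p, q, hp, hq, h1, h2, h3⟩ := Nat.exists_prime_pair m h17
    exact hgap p q hp hq h1 h2 h3
  by_cases h14 : 14 ≤ m
  · exact ⟨11, 13, by norm_num, by norm_num, by omega, by omega, by norm_num, by omega,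
      fun α _ _ x y hα hx hy hcover =>
        alternatingGroup.exists_mulEquiv_of_orders_eleven_thirteen (by omega) hx hy hcover⟩
  by_cases h11 : 11 ≤ m
  · exact hgap 7 11 (by norm_num) (by norm_num) (by omega) (by norm_num) h11
  by_cases h7 : 7 ≤ m
  · exact ⟨5, 7, by norm_num, by norm_num, by omega, by omega, by norm_num, by omega,
      fun α _ _ x y hα hx hy hcover =>
        alternatingGroup.exists_mulEquiv_of_orders_five_seven (by omega) hx hy hcover⟩
  · exact ⟨3, 5, by norm_num, by norm_num, by omega, by omega, by norm_num, by omega,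
      fun α _ _ x y hα hx hy hcover =>
        alternatingGroup.exists_mulEquiv_of_orders_three_five (by omega) hx hy hcover⟩

theorem proposition3p4 (m : ℕ) (hm : 5 ≤ m) :
    ∃ p q : ℕ, p.Prime ∧ q.Prime ∧
      (m : ℚ) / 2 ≤ p ∧ (m ≠ 6 → m ≠ 10 → (m : ℚ) / 2 < p) ∧ p < q ∧ q ≤ m ∧
      ∀ x y : alternatingGroup (Fin m), orderOf x = p → orderOf y = q →
        (∃ d : ℕ, 5 ≤ d ∧
          Nonempty (Subgroup.closure ({x, y} : Set (alternatingGroup (Fin m))) ≃*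
            alternatingGroup (Fin d))) ∧
        ¬ Group.IsSolvable (Subgroup.closure ({x, y} : Set (alternatingGroup (Fin m)))) := by
  obtain ⟨p, q, hp, hq, h1, h2, hpq, hqm, h⟩ := exists_primes_forall_closure_pair_mulEquiv m hm
  refine ⟨p, q, hp, hq, ?_, fun h6 h10 => ?_, hpq, hqm, fun x y hx hy => ?_⟩
  · rw [div_le_iff₀' two_pos]
    exact_mod_cast h1
  · rw [div_lt_iff₀' two_pos]
    exact_mod_cast h2 h6 h10
  -- Removing common fixed points makes the degree, and hence d, depend on x and y.
  · obtain ⟨s, x', y', hx', hy', hcover, ⟨e⟩⟩ := alternatingGroup.exists_closure_pair_mulEquiv x y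
    have hs : Nat.card s ≤ m := by
      rw [Nat.card_eq_fintype_card, Fintype.card_coe]
      exact s.card_le_univ.trans (Fintype.card_fin m).le
    obtain ⟨d, hd, ⟨e'⟩⟩ := h s x' y' hs (hx'.trans hx) (hy'.trans hy) hcover
    refine ⟨⟨d, hd, ⟨e.trans e'⟩⟩, fun hsol => ?_⟩
    refine alternatingGroup.not_isSolvable_of_five_le (α := Fin d) (by simpa using hd) ?_
    exact Group.isSolvable_of_surjective (f := (e.trans e').toMonoidHom) (e.trans e').surjective
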